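/- Let $p$ be a prime, $1\le k\le n$, and let $U$ (resp. $U^-$) be the group of upper (resp. lower) triangular matrices in $\mathrm{GL}_{n+1}$ with diagonal entries $1$. Put $U(\mathbb Z_p)=U(\mathbb Q_p)\cap \mathrm{GL}_{n+1}(\mathbb Z_p)$, $$w=w_{k,n+1-k}=\begin{pmatrix}0&(-1)^{n+1-k}I_k\\ I_{n+1-k}&0\end{pmatrix},\qquad U_w=U\cap w^{-1}U^-w .$$ For $r\in\mathbb Z_{\ge0}^n$ let $\mathfrak n=\mathfrak c\,w$ with $\mathfrak c=\mathrm{diag}(p^{-r_1},p^{r_1-r_2},\dots,p^{r_{n-1}-r_n},p^{r_n})$, and $C(\mathfrak n)=U(\mathbb Q_p)\,\mathfrak n\,U(\mathbb Q_p)\cap \mathrm{GL}_{n+1}(\mathbb Z_p)$. All families below are indexed by the pairs $(i,j)$ with $1\le i\le k\le j\le n$. For the $t$-th simple root let $\phi_t:\mathrm{SL}_2\to\mathrm{GL}_{n+1}$ be the embedding in rows and columns $t,t+1$. For $a\in\mathbb Q_p$ put $$b_t(a)=\phi_t\begin{pmatrix}0&-1\\1&a\end{pmatrix}\ \text{ and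 }\ \mu(a)=0\ \text{ if } a\in\mathbb Z_p;\qquad b_t(a)=\phi_t\begin{pmatrix}c^{-1}&0\\p^{m}&c\end{pmatrix}\ \text{ and }\ \mu(a)=m\ \text{ if } a=cp^{-m},\ c\in\mathbb Z_p^{*},\ m>0,$$ and for a family $a=(a_{i,j})$ in $\mathbb Q_p$ let $b(a)=\prod b_{i+j-k}(a_{i,j})$, the product being taken in the order $(k,k),\dots,(k,n),(k-1,k),\dots,(k-1,n),\dots,(1,k),\dots,(1,n)$. For a family $m=(m_{i,j})$ of non-negative integers let $Y(m)=\{a:\mu(a_{i,j})=m_{i,j}\text{ for all }i,j\}$, $$M_{i,j}=\sum_{l=1}^{i-1}m_{l,j}+\sum_{l=j+1}^{n}m_{i,l}+m_{i,j},$$ $$C_w(m)=\{(c_{i,j})\in\mathbb Z^{k(n+1-k)}:\ 0\le c_{i,j}<p^{M_{i,j}},\ (c_{i,j},p^{m_{i,j}})=1\text{ for all }i,j\},$$ and let $\mathcal M_w(r)$ be the set of all $m$ with $\sum_{i\le l\le j}m_{i,j}=r_l$ for $1\le l\le n$. To $c\in C_w(m)$ attach $a(m,c)=(c_{i,j}p^{-m_{i,j}})_{i,j}\in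 Y(m)$. **Theorem 3.2.** (1) Let $m\in\mathcal M_w(r)$. Then $b$ induces an injective map from $Y(m)$ to $U(\mathbb Z_p)\backslash C(\mathfrak n)$. There is a right action $*$ of $U_w(\mathbb Z_p)$ on $Y(m)$ for which this map is equivariant, i.e. $U(\mathbb Z_p)\,b(a*u)=U(\mathbb Z_p)\,b(a)\,u$, and $c\mapsto a(m,c)$ identifies $C_w(m)$ with a system of representatives of $Y(m)/U_w(\mathbb Z_p)$: the $a(m,c)$, $c\in C_w(m)$, are pairwise inequivalent under the action, and every element of $Y(m)$ is equivalent to one of them. (2) The map $(m,c)\mapsto U(\mathbb Z_p)\,b(a(m,c))\,U_w(\mathbb Z_p)$ is a bijection from the disjoint union of the sets $C_w(m)$, $m\in\mathcal M_w(r)$, onto $U(\mathbb Z_p)\backslash C(\mathfrak n)/U_w(\mathbb Z_p)$. -/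

import Mathlib

open Matrix

namespace Kloos

noncomputable section

/-! ### Unipotent subgroups of the general linear group -/

/-- The group `U(K)` of upper triangular matrices with all diagonal entries equal to `1`. -/
def upperUnip (N : ℕ) (K : Type*) [Field K] : Subgroup (GL (Fin N) K) where
  carrier := {g | (∀ x y, y < x → g.val x y = 0) ∧ ∀ x, g.val x x = 1}
  one_mem' := by
    refine ⟨fun x y h => ?_, fun x => ?_⟩
    · simp [h.ne']
    · simp
  mul_mem' := by
    rintro a b ⟨ha, ha'⟩ ⟨hb, hb'⟩
    refine ⟨fun x y h => ?_, fun x => ?_⟩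
    · rw [Units.val_mul, Matrix.mul_apply]
      refine Finset.sum_eq_zero fun z _ => ?_
      rcases lt_or_ge z x with hz | hz
      · rw [ha x z hz, zero_mul]
      · rw [hb z y (h.trans_le hz), mul_zero]
    · rw [Units.val_mul, Matrix.mul_apply, Finset.sum_eq_single x]
      · rw [ha', hb', one_mul]
      · intro z _ hz
        rcases lt_or_gt_of_ne hz with hz | hz
        · rw [ha x z hz, zero_mul]
        · rw [hb z x hz, mul_zero]
      · simp
  inv_mem' := by
    rintro a ⟨ha, ha'⟩
    have hT : Matrix.BlockTriangular a.val id := fun x y h => ha x y h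
    have hI : Matrix.BlockTriangular (a⁻¹).val id := by
      have : Invertible a.val := a.invertible
      have := Matrix.blockTriangular_inv_of_blockTriangular hT
      rwa [← Matrix.coe_units_inv] at this
    refine ⟨fun x y h => hI h, fun x => ?_⟩
    have h1 : (a.val * (a⁻¹).val) x x = 1 := by
      rw [← Units.val_mul, mul_inv_cancel, Units.val_one, Matrix.one_apply_eq]
    rw [Matrix.mul_apply, Finset.sum_eq_single x] at h1
    · rwa [ha', one_mul] at h1
    · intro z _ hz
      rcases lt_or_gt_of_ne hz with hz | hz
      · rw [ha x z hz, zero_mul]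
      · rw [show (a⁻¹).val z x = 0 from hI hz, mul_zero]
    · simp

/-- The transpose of an invertible matrix. -/
def transposeGL {N : ℕ} {K : Type*} [Field K] (g : GL (Fin N) K) : GL (Fin N) K :=
  ⟨g.valᵀ, (g⁻¹).valᵀ,
    by rw [← Matrix.transpose_mul, ← Units.val_mul, inv_mul_cancel]; simp,
    by rw [← Matrix.transpose_mul, ← Units.val_mul, mul_inv_cancel]; simp⟩

/-- The group `U⁻(K)` of lower triangular matrices with all diagonal entries equal to `1`,
that is, of the transposes of the elements of `U(K)`. -/
def lowerUnip (N : ℕ) (K : Type*) [Field K] : Subgroup (GL (Fin N) K) where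
  carrier := {g | transposeGL g ∈ upperUnip N K}
  one_mem' := by
    have h : transposeGL (1 : GL (Fin N) K) = 1 := Units.ext (by simp [transposeGL])
    simp [h]
  mul_mem' := by
    intro a b ha hb
    have h : transposeGL (a * b) = transposeGL b * transposeGL a :=
      Units.ext (by simp [transposeGL])
    simpa [h] using (upperUnip N K).mul_mem hb ha
  inv_mem' := by
    intro a ha
    have h : transposeGL a⁻¹ = (transposeGL a)⁻¹ := Units.ext rfl
    simpa [h] using (upperUnip N K).inv_mem ha

/-! ### The embeddings of `SL₂` attached to the simple roots -/

/-- The matrix which agrees with the identity except that the `2 × 2` block in the (0-based) rows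
and columns `t`, `t + 1` is `A`. -/
def rootMatrix {n : ℕ} {K : Type*} [Field K] (t : Fin n) (A : Matrix (Fin 2) (Fin 2) K) :
    Matrix (Fin (n + 1)) (Fin (n + 1)) K :=
  Matrix.of fun x y =>
    if x = t.castSucc ∧ y = t.castSucc then A 0 0
    else if x = t.castSucc ∧ y = t.succ then A 0 1
    else if x = t.succ ∧ y = t.castSucc then A 1 0
    else if x = t.succ ∧ y = t.succ then A 1 1
    else if x = y then 1 else 0

theorem rootMatrix_one {n : ℕ} {K : Type*} [Field K] (t : Fin n) :
    rootMatrix t (1 : Matrix (Fin 2) (Fin 2) K) = 1 := by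
  have hne : t.castSucc ≠ t.succ := (Fin.castSucc_lt_succ).ne
  ext x y
  simp only [rootMatrix, Matrix.of_apply, Matrix.one_apply]
  by_cases h1 : x = t.castSucc <;> by_cases h2 : x = t.succ <;>
    by_cases h3 : y = t.castSucc <;> by_cases h4 : y = t.succ <;> simp_all [eq_comm]

theorem rootMatrix_mul {n : ℕ} {K : Type*} [Field K] (t : Fin n)
    (A B : Matrix (Fin 2) (Fin 2) K) :
    rootMatrix t (A * B) = rootMatrix t A * rootMatrix t B := by
  have hne : t.castSucc ≠ t.succ := (Fin.castSucc_lt_succ).ne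
  have hne' := hne.symm
  ext x y
  rw [Matrix.mul_apply]
  by_cases hx : x = t.castSucc ∨ x = t.succ
  · rw [← Finset.sum_subset (Finset.subset_univ {t.castSucc, t.succ}), Finset.sum_pair hne]
    · by_cases h1 : y = t.castSucc <;> by_cases h2 : y = t.succ <;> rcases hx with rfl | rfl <;>
        simp_all [rootMatrix, Matrix.mul_apply, Fin.sum_univ_two, eq_comm]
    · intro z _ hz
      simp only [Finset.mem_insert, Finset.mem_singleton, not_or] at hz
      have : rootMatrix t A x z = 0 := by
        have : x ≠ z := by rintro rfl; tauto
        simp [rootMatrix, hz.1, hz.2, this]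
      rw [this, zero_mul]
  · rw [not_or] at hx
    rw [Finset.sum_eq_single x]
    · simp [rootMatrix, hx.1, hx.2]
    · intro z _ hz
      simp [rootMatrix, hx.1, hx.2, hz.symm]
    · simp

/-- The embedding `φ_α : SL₂(K) → GL_{n+1}(K)` attached to the `t`-th simple root
(`t = 0, …, n - 1` stands for `α₁, …, αₙ`). -/
def phi {n : ℕ} {K : Type*} [Field K] (t : Fin n) :
    SpecialLinearGroup (Fin 2) K →* GL (Fin (n + 1)) K where
  toFun A := ⟨rootMatrix t A.val, rootMatrix t (A⁻¹).val,
    by rw [← rootMatrix_mul]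
       exact (congrArg (fun B : SpecialLinearGroup (Fin 2) K => rootMatrix t B.val)
         (mul_inv_cancel A)).trans (rootMatrix_one t),
    by rw [← rootMatrix_mul]
       exact (congrArg (fun B : SpecialLinearGroup (Fin 2) K => rootMatrix t B.val)
         (inv_mul_cancel A)).trans (rootMatrix_one t)⟩
  map_one' := Units.ext (by simp [rootMatrix_one])
  map_mul' A B := Units.ext (by simp [rootMatrix_mul])

/-! ### The Weyl element with two blocks -/

/-- The matrix `[[0, ε I_k], [I_{n+1-k}, 0]]` with `ε = (-1)^(n+1-k)`; the sign makes its
determinant equal to `1`. -/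
def weylMatrix (K : Type*) [Field K] (n k : ℕ) : Matrix (Fin (n + 1)) (Fin (n + 1)) K :=
  Matrix.of fun x y =>
    if x.val < k then (if y.val = x.val + (n + 1 - k) then (-1) ^ (n + 1 - k) else 0)
    else (if x.val = y.val + k then 1 else 0)

theorem weylMatrix_mul_transpose (K : Type*) [Field K] (n k : ℕ) :
    weylMatrix K n k * (weylMatrix K n k)ᵀ = 1 := by
  ext x z
  rw [Matrix.mul_apply]
  by_cases hx : x.val < k
  · rw [Finset.sum_eq_single (⟨x.val + (n + 1 - k), by have := x.isLt; omega⟩ : Fin (n + 1))]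
    · have hs : ((-1 : K) ^ (n + 1 - k)) * (-1) ^ (n + 1 - k) = 1 := by
        rw [← mul_pow]; simp
      by_cases hxz : x = z
      · subst hxz
        simp [weylMatrix, hx, hs]
      · have h1 : x.val ≠ z.val := fun h => hxz (Fin.ext h)
        have h2 := z.isLt
        simp only [weylMatrix, Matrix.transpose_apply, Matrix.of_apply, Matrix.one_apply, hxz,
          if_false]
        split_ifs <;> first | omega | simp
    · intro y _ hy
      have : y.val ≠ x.val + (n + 1 - k) := fun h => hy (Fin.ext h)
      simp [weylMatrix, hx, this]
    · simp
  · rw [Finset.sum_eq_single (⟨x.val - k, by have := x.isLt; omega⟩ : Fin (n + 1))]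
    · by_cases hxz : x = z
      · subst hxz
        have : x.val = x.val - k + k := by omega
        simp [weylMatrix, hx, ← this]
      · have h1 : x.val ≠ z.val := fun h => hxz (Fin.ext h)
        have h2 := x.isLt
        simp only [weylMatrix, Matrix.transpose_apply, Matrix.of_apply, Matrix.one_apply, hxz,
          if_false]
        split_ifs <;> first | omega | simp
    · intro y _ hy
      have : x.val ≠ y.val + k := fun h => hy (Fin.ext (by simp; omega))
      simp [weylMatrix, hx, this]
    · simp

/-- The Weyl element `w_{k,n+1-k}`, represented by a matrix of determinant `1`. -/
def weyl (K : Type*) [Field K] (n k : ℕ) : GL (Fin (n + 1)) K :=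
  ⟨weylMatrix K n k, (weylMatrix K n k)ᵀ, weylMatrix_mul_transpose K n k,
    mul_eq_one_comm.mp (weylMatrix_mul_transpose K n k)⟩

/-- The group `U_w(K) = U(K) ∩ w⁻¹ U⁻(K) w` for `w = w_{k,n+1-k}`. -/
def unipW (n k : ℕ) (K : Type*) [Field K] : Subgroup (GL (Fin (n + 1)) K) :=
  upperUnip (n + 1) K ⊓ (lowerUnip (n + 1) K).map (MulAut.conj (weyl K n k)⁻¹).toMonoidHom

/-! ### Integral points and the Kloosterman set -/

/-- The subgroup `GL_N(ℤ_p)` of `GL_N(ℚ_p)`. -/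
def integralGL (p : ℕ) [Fact p.Prime] (N : ℕ) : Subgroup (GL (Fin N) ℚ_[p]) :=
  (GeneralLinearGroup.map (n := Fin N) (algebraMap ℤ_[p] ℚ_[p])).range

/-- `U(ℤ_p)`, as a subgroup of `GL_{n+1}(ℚ_p)`. -/
def UZ (p : ℕ) [Fact p.Prime] (n : ℕ) : Subgroup (GL (Fin (n + 1)) ℚ_[p]) :=
  upperUnip (n + 1) ℚ_[p] ⊓ integralGL p (n + 1)

/-- `U_w(ℤ_p)` for `w = w_{k,n+1-k}`, as a subgroup of `GL_{n+1}(ℚ_p)`. -/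
def UwZ (p : ℕ) [Fact p.Prime] (n k : ℕ) : Subgroup (GL (Fin (n + 1)) ℚ_[p]) :=
  unipW n k ℚ_[p] ⊓ integralGL p (n + 1)

theorem p_ne_zero (p : ℕ) [Fact p.Prime] : (p : ℚ_[p]) ≠ 0 :=
  Nat.cast_ne_zero.mpr (Fact.out : p.Prime).ne_zero

/-- The exponents `-r₁, r₁ - r₂, …, r_{n-1} - r_n, r_n`; here `r t` stands for `r_{t+1}`. -/
def modulusExp {n : ℕ} (r : Fin n → ℕ) (x : Fin (n + 1)) : ℤ :=
  (Fin.cons (α := fun _ => ℕ) 0 r x : ℤ) - (Fin.snoc (α := fun _ => ℕ) r 0 x : ℤ)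

/-- The modulus `𝔠 = diag(p^{-r₁}, p^{r₁-r₂}, …, p^{r_{n-1}-r_n}, p^{r_n})`. -/
def modulus (p : ℕ) [Fact p.Prime] {n : ℕ} (r : Fin n → ℕ) : GL (Fin (n + 1)) ℚ_[p] :=
  ⟨diagonal fun x => (p : ℚ_[p]) ^ modulusExp r x,
    diagonal fun x => (p : ℚ_[p]) ^ (-modulusExp r x),
    by rw [diagonal_mul_diagonal, ← diagonal_one]
       simp only [← zpow_add₀ (p_ne_zero p), add_neg_cancel, zpow_zero],
    by rw [diagonal_mul_diagonal, ← diagonal_one]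
       simp only [← zpow_add₀ (p_ne_zero p), neg_add_cancel, zpow_zero]⟩

/-- `C(𝔫) = U(ℚ_p) 𝔫 U(ℚ_p) ∩ GL_{n+1}(ℤ_p)` for `𝔫 = 𝔠 w`, where `𝔠` is the modulus with exponent
vector `r` and `w = w_{k,n+1-k}`. -/
def kloosC (p : ℕ) [Fact p.Prime] {n : ℕ} (k : ℕ) (r : Fin n → ℕ) :
    Set (GL (Fin (n + 1)) ℚ_[p]) :=
  {g | (∃ x ∈ upperUnip (n + 1) ℚ_[p], ∃ y ∈ upperUnip (n + 1) ℚ_[p],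
      g = x * (modulus p r * weyl ℚ_[p] n k) * y) ∧ g ∈ integralGL p (n + 1)}

/-- The class of `g` in `U(ℤ_p) \ GL_{n+1}(ℚ_p)`. -/
def leftClass (p : ℕ) [Fact p.Prime] {n : ℕ} (g : GL (Fin (n + 1)) ℚ_[p]) :
    Quotient (QuotientGroup.rightRel (UZ p n)) :=
  Quotient.mk _ g

/-- The class of `g` in `U(ℤ_p) \ GL_{n+1}(ℚ_p) / U_w(ℤ_p)`. -/
def doubleClass (p : ℕ) [Fact p.Prime] {n : ℕ} (k : ℕ) (g : GL (Fin (n + 1)) ℚ_[p]) :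
    DoubleCoset.Quotient (UZ p n : Set (GL (Fin (n + 1)) ℚ_[p]))
      (UwZ p n k : Set (GL (Fin (n + 1)) ℚ_[p])) :=
  Quotient.mk _ g

/-- The Kloosterman set `X(𝔫) = U(ℤ_p) \ C(𝔫) / U_w(ℤ_p)`. -/
def kloosX (p : ℕ) [Fact p.Prime] {n : ℕ} (k : ℕ) (r : Fin n → ℕ) :
    Set (DoubleCoset.Quotient (UZ p n : Set (GL (Fin (n + 1)) ℚ_[p]))
      (UwZ p n k : Set (GL (Fin (n + 1)) ℚ_[p]))) :=
  doubleClass p k '' kloosC p k r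

/-! ### The map `b` and the strata `Y(m)` -/

/-- `μ(a) = 0` if `a ∈ ℤ_p`, and `μ(a) = -v_p(a)` otherwise. -/
def mu {p : ℕ} [Fact p.Prime] (a : ℚ_[p]) : ℕ :=
  if ‖a‖ ≤ 1 then 0 else (-a.valuation).toNat

/-- The matrix `(0, -1; 1, a)` if `a ∈ ℤ_p`, and `(c⁻¹, 0; p^m, c)` if `a = c p^{-m}` with
`c ∈ ℤ_p^*` and `m > 0`. -/
def bSL {p : ℕ} [Fact p.Prime] (a : ℚ_[p]) : SpecialLinearGroup (Fin 2) ℚ_[p] :=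
  if h : ‖a‖ ≤ 1 then ⟨!![0, -1; 1, a], by simp [Matrix.det_fin_two]⟩
  else ⟨!![(a * (p : ℚ_[p]) ^ mu a)⁻¹, 0; (p : ℚ_[p]) ^ mu a, a * (p : ℚ_[p]) ^ mu a], by
    have ha : a ≠ 0 := by rintro rfl; simp at h
    have hc : a * (p : ℚ_[p]) ^ mu a ≠ 0 := mul_ne_zero ha (pow_ne_zero _ (p_ne_zero p))
    rw [Matrix.det_fin_two_of, inv_mul_cancel₀ hc, zero_mul, sub_zero]⟩

/-- Families indexed by the pairs `1 ≤ i ≤ k ≤ j ≤ n`: the (0-based) pair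
`(i, j) : Fin k × Fin (n + 1 - k)` stands for the pair `(i + 1, k + j)`. -/
abbrev Family (n k : ℕ) (α : Type*) : Type _ := Fin k → Fin (n + 1 - k) → α

/-- The simple root occurring at the position `(i, j)` of the reduced expression
`w_{k,n+1-k} = (s_k ⋯ s_n) (s_{k-1} ⋯ s_{n-1}) ⋯ (s_1 ⋯ s_{n+1-k})`; in 1-based notation the
position `(i, j)` carries `s_{i+j-k}`. -/
def simpleAt {n k : ℕ} (i : Fin k) (j : Fin (n + 1 - k)) : Fin n :=
  ⟨i.val + j.val, by have := i.isLt; have := j.isLt; omega⟩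

/-- `b(a)`: the product of the `b_α(a_{i,j})` along the reduced expression above, i.e. in the order
`(k,k), …, (k,n), (k-1,k), …, (k-1,n), …, (1,k), …, (1,n)`. -/
def bMap {p : ℕ} [Fact p.Prime] {n k : ℕ} (a : Family n k ℚ_[p]) : GL (Fin (n + 1)) ℚ_[p] :=
  ((List.finRange k).reverse.map fun i =>
    ((List.finRange (n + 1 - k)).map fun j => phi (simpleAt i j) (bSL (a i j))).prod).prod

/-- The stratum `Y(m)`. -/
def Y (p : ℕ) [Fact p.Prime] {n k : ℕ} (m : Family n k ℕ) : Set (Family n k ℚ_[p]) :=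
  {a | ∀ i j, mu (a i j) = m i j}

/-! ### The parameter sets -/

/-- `𝓜_w(r)`: the families `m` with `∑_{i ≤ l ≤ j} m_{i,j} = r_l` for `1 ≤ l ≤ n`. -/
def MSet {n : ℕ} (k : ℕ) (r : Fin n → ℕ) : Set (Family n k ℕ) :=
  {m | ∀ l : Fin n,
    (∑ i : Fin k, ∑ j : Fin (n + 1 - k),
      if i.val + 1 ≤ l.val + 1 ∧ l.val + 1 ≤ k + j.val then m i j else 0) = r l}

/-- `M_{i,j} = ∑_{l < i} m_{l,j} + ∑_{l > j} m_{i,l} + m_{i,j}`. -/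
def bigM {n k : ℕ} (m : Family n k ℕ) (i : Fin k) (j : Fin (n + 1 - k)) : ℕ :=
  ∑ l ∈ Finset.Iio i, m l j + ∑ l ∈ Finset.Ioi j, m i l + m i j

/-- `C_w(m)`: the integer families `c` with `0 ≤ c_{i,j} < p^{M_{i,j}}` and
`(c_{i,j}, p^{m_{i,j}}) = 1`. -/
def CSet (p : ℕ) {n k : ℕ} (m : Family n k ℕ) : Set (Family n k ℤ) :=
  {c | ∀ i j, 0 ≤ c i j ∧ c i j < (p : ℤ) ^ bigM m i j ∧ Int.gcd (c i j) ((p : ℤ) ^ m i j) = 1}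

/-- The family `a_{i,j} = c_{i,j} p^{-m_{i,j}}` attached to `m` and `c`. -/
def param (p : ℕ) [Fact p.Prime] {n k : ℕ} (m : Family n k ℕ) (c : Family n k ℤ) :
    Family n k ℚ_[p] :=
  fun i j => (c i j : ℚ_[p]) * (p : ℚ_[p]) ^ (-(m i j : ℤ))

theorem mu_param (p : ℕ) [Fact p.Prime] (m : ℕ) (c : ℤ) (h : Int.gcd c ((p : ℤ) ^ m) = 1) :
    mu ((c : ℚ_[p]) * (p : ℚ_[p]) ^ (-(m : ℤ))) = m := by
  rcases Nat.eq_zero_or_pos m with rfl | hm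
  · simp [mu, Padic.norm_int_le_one]
  · have hp : p.Prime := Fact.out
    have hnd : ¬ (p : ℤ) ∣ c := by
      intro hd
      have h2 : (p : ℤ) ∣ (Int.gcd c ((p : ℤ) ^ m) : ℤ) :=
        Int.dvd_coe_gcd hd (dvd_pow_self _ hm.ne')
      rw [h] at h2
      have h3 : p ∣ 1 := by exact_mod_cast h2
      exact hp.one_lt.ne' (Nat.dvd_one.mp h3)
    have hc : ‖(c : ℚ_[p])‖ = 1 := by
      refine le_antisymm (Padic.norm_int_le_one c) (not_lt.mp fun hlt => hnd ?_)
      exact Padic.norm_intCast_lt_one_iff.mp hlt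
    have hn : ‖(c : ℚ_[p]) * (p : ℚ_[p]) ^ (-(m : ℤ))‖ = (p : ℝ) ^ (m : ℤ) := by
      rw [norm_mul, hc, one_mul, Padic.norm_p_zpow, neg_neg]
    have hp1 : (1 : ℝ) < p := by exact_mod_cast hp.one_lt
    have hgt : ¬ ‖(c : ℚ_[p]) * (p : ℚ_[p]) ^ (-(m : ℤ))‖ ≤ 1 := by
      rw [hn, not_le, zpow_natCast]
      exact one_lt_pow₀ hp1 hm.ne'
    have hne : (c : ℚ_[p]) * (p : ℚ_[p]) ^ (-(m : ℤ)) ≠ 0 := by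
      intro h0; rw [h0] at hgt; simp at hgt
    have hv := Padic.norm_eq_zpow_neg_valuation hne
    rw [hn] at hv
    have hv' := zpow_right_injective₀ (by linarith) hp1.ne' hv
    rw [mu, if_neg hgt, ← hv', Int.toNat_natCast]

/-- The point of `Y(m)` attached to an element of `C_w(m)`. -/
def paramY (p : ℕ) [Fact p.Prime] {n k : ℕ} (m : Family n k ℕ) (c : CSet p m) : Y p m :=
  ⟨param p m c.val, fun i j => mu_param p (m i j) (c.val i j) (c.property i j).2.2⟩

end

end Kloos

/-! Put q = n+1-k and let y(X) in U_w be the unipotent matrix with upper right block X. The proof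
writes b(a) = B w y(X) with B upper triangular and powers of p on its diagonal, and works with the
coordinates X instead of a.

One factor b_t(a) sends e_t to p^{μ(a)} e_{t+1} modulo e_t, and e_{t+1} - a e_t to -p^{-μ(a)} e_t.
Following these two rules through the rows of the product gives, for each a, a basis which b(a) maps
to a triangular family (`partProd_flagVec`, `isTri_bMap`). The condition linking a and X is
triangular: with the pairs ordered by increasing i and then decreasing j, a_{i,j} = ±p^e X_{i,j} +
(earlier terms), where e is the sum of μ(a_{l,j}) over l < i and of μ(a_{i,l}) over l > j. So a and
X determine each other.

The crucial fact is that an integral translation of X preserves every μ(a_{i,j}) (`IsCoord.mu_eq`).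
The two partial products of rows differ by a triangular matrix in GL(ℤ_p) whose diagonal entries are
powers of p, hence 1; comparing consecutive partial products isolates each μ. Therefore U_w(ℤ_p)
acts on Y(m) by translating coordinates, and b is equivariant because the diagonals of the B's
cancel (`bMap_mul_inv_mem_UZ`). Injectivity holds because w y(X) w⁻¹ is lower unipotent, so it is
upper triangular only for X = 0 (`coord_eq_of_bMap_eq`).

For representatives, an integral change of X_{i,j} alone moves a_{i,j} p^{m_{i,j}} by an arbitrary
element of p^M ℤ_p, with M = e + m_{i,j} = M_{i,j}, and leaves the earlier entries fixed. Each entry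
in turn is thus brought to a unique integer in [0, p^M) over p^{m_{i,j}} (`exists_representative`,
`representative_unique`).

For surjectivity, g in C(𝔫) also has the form B' w y(X). If a has coordinates X, then g b(a)⁻¹ is
triangular and lies in GL(ℤ_p), so its diagonal powers of p are 1; this equality of exponents is the
condition defining 𝓜_w(r) (`exists_bMap_mem_UZ_mul`). -/

namespace Kloos

noncomputable section

/-! ### Triangular matrices through their action on the standard flag. -/

section Flag

variable {N : ℕ} {K : Type*} [Field K]

/-- The standard basis vector with index `y : ℕ`; it is zero if `y` is out of range. -/
def stdVec (N : ℕ) (K : Type*) [Field K] (y : ℕ) : Fin N → K := fun x => if x.val = y then 1 else 0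

/-- The span of the first `y` standard basis vectors. -/
def flag (N : ℕ) (K : Type*) [Field K] (y : ℕ) : Submodule K (Fin N → K) where
  carrier := {v | ∀ x : Fin N, y ≤ x.val → v x = 0}
  add_mem' := fun ha hb x hx => by simp [ha x hx, hb x hx]
  zero_mem' := fun _ _ => rfl
  smul_mem' := fun c v hv x hx => by simp [hv x hx]

theorem flag_mono {y z : ℕ} (h : y ≤ z) : flag N K y ≤ flag N K z :=
  fun _ hv x hx => hv x (h.trans hx)

theorem stdVec_mem_flag {y z : ℕ} (h : z < y) : stdVec N K z ∈ flag N K y := by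
  intro x hx
  have : x.val ≠ z := by omega
  simp [stdVec, this]

theorem stdVec_of_le {y : ℕ} (h : N ≤ y) : stdVec N K y = 0 := by
  ext x
  have : x.val ≠ y := by have := x.isLt; omega
  simp [stdVec, this]

theorem eq_sum_stdVec (v : Fin N → K) : v = ∑ x : Fin N, v x • stdVec N K x.val := by
  ext z
  simp [Finset.sum_apply, stdVec, ← Fin.ext_iff]

theorem mulVec_stdVec (A : Matrix (Fin N) (Fin N) K) (x y : Fin N) :
    (A *ᵥ stdVec N K y.val) x = A x y := by
  simp [Matrix.mulVec, dotProduct, stdVec, ← Fin.ext_iff]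

theorem ext_stdVec {A B : Matrix (Fin N) (Fin N) K}
    (h : ∀ y < N, A *ᵥ stdVec N K y = B *ᵥ stdVec N K y) : A = B := by
  ext x y
  rw [← mulVec_stdVec A, ← mulVec_stdVec B, h y.val y.isLt]

theorem mulVec_mem_of_flag {A : Matrix (Fin N) (Fin N) K} {S : Submodule K (Fin N → K)} {y : ℕ}
    (h : ∀ z < y, z < N → A *ᵥ stdVec N K z ∈ S) {v : Fin N → K} (hv : v ∈ flag N K y) :
    A *ᵥ v ∈ S := by
  rw [eq_sum_stdVec v, Matrix.mulVec_sum]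
  refine S.sum_mem fun x _ => ?_
  rw [Matrix.mulVec_smul]
  by_cases hx : x.val < y
  · exact S.smul_mem _ (h _ hx x.isLt)
  · rw [hv x (not_lt.mp hx), zero_smul]
    exact S.zero_mem

theorem mulVec_eq_of_flag {A B : Matrix (Fin N) (Fin N) K} {y : ℕ}
    (h : ∀ z < y, A *ᵥ stdVec N K z = B *ᵥ stdVec N K z) {v : Fin N → K} (hv : v ∈ flag N K y) :
    A *ᵥ v = B *ᵥ v := by
  have := mulVec_mem_of_flag (A := A - B) (S := ⊥) (y := y)
    (fun z hz _ => by rw [Matrix.sub_mulVec, h z hz, sub_self]; exact zero_mem _) hv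
  rwa [Submodule.mem_bot, Matrix.sub_mulVec, sub_eq_zero] at this

/-- `v` is `c` times the `y`-th basis vector, up to a combination of the earlier ones. -/
def Leads (v : Fin N → K) (c : K) (y : ℕ) : Prop := v - c • stdVec N K y ∈ flag N K y

theorem Leads.mem_flag {v : Fin N → K} {c : K} {y z : ℕ} (h : Leads v c y) (hz : y < z) :
    v ∈ flag N K z := by
  have := add_mem (flag_mono hz.le h) ((flag N K z).smul_mem c (stdVec_mem_flag hz))
  rwa [sub_add_cancel] at this

theorem Leads.apply {v : Fin N → K} {c : K} {y : Fin N} (h : Leads v c y.val) : v y = c := by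
  have := h y le_rfl
  simpa [stdVec, sub_eq_zero] using this

/-- `g` is upper triangular with diagonal `d`. -/
def IsTri (g : GL (Fin N) K) (d : ℕ → K) : Prop :=
  ∀ y < N, Leads (g.val *ᵥ stdVec N K y) (d y) y

theorem IsTri.mem_flag {g : GL (Fin N) K} {d : ℕ → K} (h : IsTri g d) {y : ℕ} {v : Fin N → K}
    (hv : v ∈ flag N K y) : g.val *ᵥ v ∈ flag N K y :=
  mulVec_mem_of_flag (fun z hz hN => (h z hN).mem_flag hz) hv

theorem IsTri.leads {g : GL (Fin N) K} {d : ℕ → K} (h : IsTri g d) {y : ℕ} (hy : y < N)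
    {v : Fin N → K} {c : K} (hv : Leads v c y) : Leads (g.val *ᵥ v) (d y * c) y := by
  have h1 := h.mem_flag hv
  have h2 := (flag N K y).smul_mem c (h y hy)
  have := add_mem h1 h2
  rw [Matrix.mulVec_sub, Matrix.mulVec_smul] at this
  unfold Leads
  convert this using 1
  rw [smul_sub, smul_smul, mul_comm c]
  abel

theorem IsTri.mul {g h : GL (Fin N) K} {d e : ℕ → K} (hg : IsTri g d) (hh : IsTri h e) :
    IsTri (g * h) (fun y => d y * e y) := fun y hy => by
  have := hg.leads hy (hh y hy)
  rwa [Matrix.mulVec_mulVec, ← Units.val_mul] at this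

/-- If `G` and `G'` send the same vectors to triangular families, then `G' G⁻¹` is triangular. -/
theorem isTri_mul_inv {G G' : GL (Fin N) K} {f : ℕ → Fin N → K} {c c' : ℕ → K}
    (hc : ∀ y < N, c y ≠ 0) (h : ∀ y < N, Leads (G.val *ᵥ f y) (c y) y)
    (h' : ∀ y < N, Leads (G'.val *ᵥ f y) (c' y) y) : IsTri (G' * G⁻¹) (fun y => c' y / c y) := by
  intro y
  induction y using Nat.strong_induction_on with
  | _ y ih =>
    intro hy
    have hflag : ∀ v ∈ flag N K y, (G' * G⁻¹).val *ᵥ v ∈ flag N K y := fun v hv =>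
      mulVec_mem_of_flag (fun z hz hN => (ih z hz hN).mem_flag hz) hv
    have h1 := hflag _ (h y hy)
    have h2 : (G' * G⁻¹).val *ᵥ (G.val *ᵥ f y) = G'.val *ᵥ f y := by
      rw [Matrix.mulVec_mulVec, ← Units.val_mul, inv_mul_cancel_right]
    rw [Matrix.mulVec_sub, h2, Matrix.mulVec_smul] at h1
    have h3 := (flag N K y).smul_mem (c y)⁻¹ (sub_mem (h' y hy) h1)
    unfold Leads
    convert h3 using 1
    rw [sub_sub_sub_cancel_left, smul_sub, smul_smul, smul_smul, inv_mul_cancel₀ (hc y hy),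
      one_smul, ← div_eq_inv_mul]

theorem isTri_one : IsTri (1 : GL (Fin N) K) (fun _ => 1) := fun y _ => by
  simp only [Leads, Units.val_one, Matrix.one_mulVec, one_smul, sub_self]
  exact zero_mem _

theorem IsTri.inv {g : GL (Fin N) K} {d : ℕ → K} (h : IsTri g d) (hd : ∀ y < N, d y ≠ 0) :
    IsTri g⁻¹ (fun y => (d y)⁻¹) := by
  have := isTri_mul_inv (G := g) (G' := 1) (f := stdVec N K) hd h isTri_one
  simpa using this

theorem mem_upperUnip_iff {g : GL (Fin N) K} : g ∈ upperUnip N K ↔ IsTri g (fun _ => 1) := by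
  constructor
  · rintro ⟨h, h1⟩ y hy x hx
    have := mulVec_stdVec g.val x ⟨y, hy⟩
    simp only at this
    rw [Pi.sub_apply, this, Pi.smul_apply, stdVec]
    rcases hx.eq_or_lt with rfl | hlt
    · simp [h1]
    · simp [h x ⟨y, hy⟩ hlt, hlt.ne']
  · intro h
    refine ⟨fun x y hxy => ?_, fun x => ?_⟩
    · refine (mulVec_stdVec g.val x y).symm.trans ?_
      exact (h y.val y.isLt).mem_flag (z := y.val + 1) (Nat.lt_succ_self _) x hxy
    · refine (mulVec_stdVec g.val x x).symm.trans ?_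
      exact (h x.val x.isLt).apply

end Flag

/-! ### Action of the simple root embeddings on basis vectors. -/

section Phi

variable {n : ℕ} {K : Type*} [Field K]

theorem phi_stdVec_of_ne (t : Fin n) (A : SpecialLinearGroup (Fin 2) K) {y : ℕ}
    (h : y ≠ t.val) (h' : y ≠ t.val + 1) :
    (phi t A).val *ᵥ stdVec (n + 1) K y = stdVec (n + 1) K y := by
  rcases lt_or_ge y (n + 1) with hy | hy
  · ext x
    rw [show stdVec (n + 1) K y = stdVec (n + 1) K (⟨y, hy⟩ : Fin (n + 1)).val from rfl,
      mulVec_stdVec]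
    simp [phi, rootMatrix, stdVec, Fin.ext_iff, h, h']
  · rw [stdVec_of_le hy, Matrix.mulVec_zero]

theorem phi_stdVec_left (t : Fin n) (A : SpecialLinearGroup (Fin 2) K) :
    (phi t A).val *ᵥ stdVec (n + 1) K t.val =
      A.val 0 0 • stdVec (n + 1) K t.val + A.val 1 0 • stdVec (n + 1) K (t.val + 1) := by
  ext x
  rw [show stdVec (n + 1) K t.val = stdVec (n + 1) K (t.castSucc).val from rfl, mulVec_stdVec]
  by_cases h : x.val = t.val <;> by_cases h' : x.val = t.val + 1 <;>
    simp [phi, rootMatrix, stdVec, Fin.ext_iff, h, h']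

theorem phi_stdVec_right (t : Fin n) (A : SpecialLinearGroup (Fin 2) K) :
    (phi t A).val *ᵥ stdVec (n + 1) K (t.val + 1) =
      A.val 0 1 • stdVec (n + 1) K t.val + A.val 1 1 • stdVec (n + 1) K (t.val + 1) := by
  ext x
  rw [show stdVec (n + 1) K (t.val + 1) = stdVec (n + 1) K (t.succ).val from rfl, mulVec_stdVec]
  by_cases h : x.val = t.val <;> by_cases h' : x.val = t.val + 1 <;>
    simp [phi, rootMatrix, stdVec, Fin.ext_iff, h, h']

end Phi

variable {p : ℕ} [Fact p.Prime] {n k : ℕ}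

/-! ### Entries of the matrices b_t(a), treated uniformly in the two cases. -/

section BSL

theorem bSL_one_zero (a : ℚ_[p]) : (bSL a).val 1 0 = (p : ℚ_[p]) ^ mu a := by
  by_cases h : ‖a‖ ≤ 1 <;> simp [bSL, h, mu]

theorem bSL_one_one (a : ℚ_[p]) : (bSL a).val 1 1 = a * (p : ℚ_[p]) ^ mu a := by
  by_cases h : ‖a‖ ≤ 1 <;> simp [bSL, h, mu]

/-- By the determinant condition and the common bottom row (p^μ, a p^μ). Equivalently, the matrix
sends e_1 - a e_0 to -p^{-μ} e_0, whichever case of the definition applies. -/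
theorem bSL_zero_one (a : ℚ_[p]) :
    (bSL a).val 0 1 = (bSL a).val 0 0 * a - ((p : ℚ_[p]) ^ mu a)⁻¹ := by
  have h := (bSL a).property
  have hp : (p : ℚ_[p]) ^ mu a ≠ 0 := pow_ne_zero _ (p_ne_zero p)
  rw [Matrix.det_fin_two, bSL_one_zero, bSL_one_one] at h
  field_simp
  linear_combination -h

theorem norm_mul_pow_mu {a : ℚ_[p]} (h : ¬ ‖a‖ ≤ 1) : ‖a * (p : ℚ_[p]) ^ mu a‖ = 1 := by
  have hp1 : (1 : ℝ) < p := by exact_mod_cast (Fact.out : p.Prime).one_lt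
  have ha : a ≠ 0 := by rintro rfl; simp at h
  have hv := Padic.norm_eq_zpow_neg_valuation ha
  have hpos : 0 < -a.valuation := by
    by_contra hn
    apply h
    rw [hv]
    exact zpow_le_one_of_nonpos₀ hp1.le (not_lt.mp hn)
  have hm : ((mu a : ℕ) : ℤ) = -a.valuation := by
    rw [mu, if_neg h, Int.toNat_of_nonneg hpos.le]
  rw [norm_mul, hv, ← zpow_natCast, Padic.norm_p_zpow, hm, ← zpow_add₀ (by linarith)]
  simp

theorem norm_bSL_le (a : ℚ_[p]) (x y : Fin 2) : ‖(bSL a).val x y‖ ≤ 1 := by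
  by_cases h : ‖a‖ ≤ 1
  · fin_cases x <;> fin_cases y <;> simp [bSL, h]
  · have h1 := norm_mul_pow_mu h
    have h2 : ‖(p : ℚ_[p]) ^ mu a‖ ≤ 1 := by
      simpa using Padic.norm_int_le_one (p := p) ((p : ℤ) ^ mu a)
    fin_cases x <;> fin_cases y
    · have h3 : (bSL a).val 0 0 = (a * (p : ℚ_[p]) ^ mu a)⁻¹ := by simp [bSL, h]
      simp only [Fin.zero_eta, h3, norm_inv, h1, inv_one, le_refl]
    · simp [bSL, h]
    · simpa [bSL_one_zero] using h2
    · simpa only [Fin.mk_one, bSL_one_one] using h1.le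

end BSL

/-! ### One row of the product: a Coxeter-type string of simple roots. -/

section Row

/-- The product of the `b_{i+j}(a_j)` for `j = 0, …, q - 1` (with 0-based simple roots). -/
def rowProd {q : ℕ} (i : ℕ) (h : i + q ≤ n) (a : Fin q → ℚ_[p]) : GL (Fin (n + 1)) ℚ_[p] :=
  ((List.finRange q).map fun j =>
    phi (⟨i + j.val, by have := j.isLt; omega⟩ : Fin n) (bSL (a j))).prod

theorem rowProd_succ {q : ℕ} (i : ℕ) (h : i + (q + 1) ≤ n) (a : Fin (q + 1) → ℚ_[p]) :
    rowProd i h a = rowProd i (by omega) (fun j => a j.castSucc) *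
      phi (⟨i + q, by omega⟩ : Fin n) (bSL (a (Fin.last q))) := by
  rw [rowProd, List.finRange_succ_last, List.map_append, List.prod_append, List.map_map]
  simp [rowProd, Function.comp_def]

/-- The column `V` such that `rowProd` maps `e_{i+q} - ∑ V_j e_{i+j}` to a multiple of `e_i`. -/
def rowVec {q : ℕ} (a : Fin q → ℚ_[p]) (j : Fin q) : ℚ_[p] :=
  (-1) ^ (q - 1 - j.val) * ((p : ℚ_[p]) ^ ∑ l ∈ Finset.Ioi j, mu (a l))⁻¹ * a j

theorem rowVec_last {q : ℕ} (a : Fin (q + 1) → ℚ_[p]) :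
    rowVec a (Fin.last q) = a (Fin.last q) := by
  have : Finset.Ioi (Fin.last q) = ∅ := by
    ext x; simp [Fin.le_last]
  simp [rowVec, this]

theorem rowVec_castSucc {q : ℕ} (a : Fin (q + 1) → ℚ_[p]) (j : Fin q) :
    rowVec a j.castSucc =
      -((p : ℚ_[p]) ^ mu (a (Fin.last q)))⁻¹ * rowVec (fun j => a j.castSucc) j := by
  have h1 : ∑ l ∈ Finset.Ioi j.castSucc, mu (a l) =
      ∑ l ∈ Finset.Ioi j, mu (a l.castSucc) + mu (a (Fin.last q)) := by
    rw [← Finset.filter_lt_eq_Ioi, Finset.sum_filter, Fin.sum_univ_castSucc,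
      ← Finset.filter_lt_eq_Ioi, Finset.sum_filter]
    simp [Fin.castSucc_lt_last]
  have h2 : q + 1 - 1 - j.castSucc.val = (q - 1 - j.val) + 1 := by
    have := j.isLt
    simp only [Fin.val_castSucc]
    omega
  rw [rowVec, rowVec, h1, h2, pow_succ, pow_add, mul_inv]
  ring

theorem rowProd_stdVec_of_ne {q : ℕ} (i : ℕ) (h : i + q ≤ n) (a : Fin q → ℚ_[p]) {y : ℕ}
    (hy : y < i ∨ i + q < y) :
    (rowProd i h a).val *ᵥ stdVec (n + 1) ℚ_[p] y = stdVec (n + 1) ℚ_[p] y := by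
  induction q with
  | zero => simp [rowProd]
  | succ q ih =>
    rw [rowProd_succ, Units.val_mul, ← Matrix.mulVec_mulVec, phi_stdVec_of_ne, ih]
    · omega
    · simp only; omega
    · simp only; omega

/-- A bound suffices: in `rowProd_leads` this vector occurs only below the leading term. -/
theorem rowProd_stdVec_last {q : ℕ} (i : ℕ) (h : i + q ≤ n) (a : Fin q → ℚ_[p]) :
    (rowProd i h a).val *ᵥ stdVec (n + 1) ℚ_[p] (i + q) ∈ flag (n + 1) ℚ_[p] (i + q + 1) := by
  induction q with
  | zero => simpa [rowProd] using stdVec_mem_flag (Nat.lt_succ_self _)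
  | succ q ih =>
    rw [rowProd_succ, Units.val_mul, ← Matrix.mulVec_mulVec]
    have h1 := phi_stdVec_right (⟨i + q, by omega⟩ : Fin n) (bSL (a (Fin.last q)))
    simp only at h1
    rw [← add_assoc, h1, Matrix.mulVec_add, Matrix.mulVec_smul, Matrix.mulVec_smul]
    refine add_mem (Submodule.smul_mem _ _ (flag_mono (Nat.le_succ _) (ih _ _)))
      (Submodule.smul_mem _ _ ?_)
    rw [rowProd_stdVec_of_ne _ _ _ (by omega)]
    exact stdVec_mem_flag (Nat.lt_succ_self _)

/-- Factors to the right of the j-th fix e_{i+j}; the j-th produces p^μ e_{i+j+1}; those to its left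
fix e_{i+j+1} and keep e_{i+j} inside the flag below it. -/
theorem rowProd_leads {q : ℕ} (i : ℕ) (h : i + q ≤ n) (a : Fin q → ℚ_[p]) (j : Fin q) :
    Leads ((rowProd i h a).val *ᵥ stdVec (n + 1) ℚ_[p] (i + j.val))
      ((p : ℚ_[p]) ^ mu (a j)) (i + j.val + 1) := by
  induction q with
  | zero => exact j.elim0
  | succ q ih =>
    rw [rowProd_succ, Units.val_mul, ← Matrix.mulVec_mulVec]
    refine Fin.lastCases ?_ (fun j => ?_) j
    · have h1 := phi_stdVec_left (⟨i + q, by omega⟩ : Fin n) (bSL (a (Fin.last q)))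
      simp only at h1
      rw [Fin.val_last, h1, Matrix.mulVec_add, Matrix.mulVec_smul, Matrix.mulVec_smul, bSL_one_zero,
        rowProd_stdVec_of_ne (y := i + q + 1) _ _ _ (by omega), Leads, add_sub_cancel_right]
      exact Submodule.smul_mem _ _ (rowProd_stdVec_last _ _ _)
    · rw [phi_stdVec_of_ne]
      · exact ih (by omega) (fun j => a j.castSucc) j
      · simp; omega
      · have := j.isLt
        simp; omega

/-- The last factor collapses e_{i+q+1} - a_q e_{i+q} to a multiple of e_{i+q} and fixes the other
e_{i+j}. The recursion for `rowVec` turns the result into -p^{-μ} times the same vector for the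
shorter row. -/
theorem rowProd_rowVec {q : ℕ} (i : ℕ) (h : i + q ≤ n) (a : Fin q → ℚ_[p]) :
    (rowProd i h a).val *ᵥ (stdVec (n + 1) ℚ_[p] (i + q) -
      ∑ j, rowVec a j • stdVec (n + 1) ℚ_[p] (i + j.val)) =
    ((-1) ^ q * ((p : ℚ_[p]) ^ ∑ j, mu (a j))⁻¹) • stdVec (n + 1) ℚ_[p] i := by
  induction q with
  | zero => simp [rowProd]
  | succ q ih =>
    have hp : (p : ℚ_[p]) ^ mu (a (Fin.last q)) ≠ 0 := pow_ne_zero _ (p_ne_zero p)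
    have h1 := phi_stdVec_left (⟨i + q, by omega⟩ : Fin n) (bSL (a (Fin.last q)))
    have h2 := phi_stdVec_right (⟨i + q, by omega⟩ : Fin n) (bSL (a (Fin.last q)))
    have h3 : ∀ j : Fin q, (phi (⟨i + q, by omega⟩ : Fin n) (bSL (a (Fin.last q)))).val *ᵥ
        stdVec (n + 1) ℚ_[p] (i + j.val) = stdVec (n + 1) ℚ_[p] (i + j.val) := fun j =>
      phi_stdVec_of_ne _ _ (by have := j.isLt; simp; omega) (by have := j.isLt; simp; omega)
    have key : (phi (⟨i + q, by omega⟩ : Fin n) (bSL (a (Fin.last q)))).val *ᵥ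
        (stdVec (n + 1) ℚ_[p] (i + (q + 1)) -
          ∑ j, rowVec a j • stdVec (n + 1) ℚ_[p] (i + j.val)) =
        (-((p : ℚ_[p]) ^ mu (a (Fin.last q)))⁻¹) • (stdVec (n + 1) ℚ_[p] (i + q) -
          ∑ j, rowVec (fun j => a j.castSucc) j • stdVec (n + 1) ℚ_[p] (i + j.val)) := by
      simp only at h1 h2
      rw [Fin.sum_univ_castSucc, rowVec_last, ← add_assoc, Matrix.mulVec_sub, Matrix.mulVec_add,
        h2, Matrix.mulVec_sum, Matrix.mulVec_smul, Fin.val_last, h1]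
      simp only [rowVec_castSucc, Fin.val_castSucc, Matrix.mulVec_smul, h3, smul_sub, smul_add,
        smul_smul, Finset.smul_sum, bSL_one_zero, bSL_one_one, bSL_zero_one]
      module
    rw [rowProd_succ, Units.val_mul, ← Matrix.mulVec_mulVec, key, Matrix.mulVec_smul, ih,
      smul_smul, Fin.sum_univ_castSucc, pow_succ, pow_add, mul_inv]
    congr 1
    ring

end Row

/-! ### Triangular systems over ℚ_p and reduction modulo integral translations. -/

theorem norm_p_pow_le (p : ℕ) [Fact p.Prime] (m : ℕ) : ‖(p : ℚ_[p]) ^ m‖ ≤ 1 := by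
  simpa using Padic.norm_int_le_one (p := p) ((p : ℤ) ^ m)

theorem norm_mul_pow_mu_le {p : ℕ} [Fact p.Prime] (a : ℚ_[p]) :
    ‖a * (p : ℚ_[p]) ^ mu a‖ ≤ 1 := by
  by_cases h : ‖a‖ ≤ 1
  · rw [norm_mul]
    exact mul_le_one₀ h (norm_nonneg _) (norm_p_pow_le p _)
  · exact (norm_mul_pow_mu h).le

/-- A system of equations `a_s = ± p^{e_s} X_s + g_s`, where `e_s` depends on the `a_t` with
`t < s` only and `g_s` on the `a_t` and `X_t` with `t < s` only. -/
structure TriangularSystem (p : ℕ) [Fact p.Prime] (ι : Type*) [LinearOrder ι] where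
  exponent : ι → (ι → ℚ_[p]) → ℕ
  sgn : ι → ℚ_[p]
  rest : ι → (ι → ℚ_[p]) → (ι → ℚ_[p]) → ℚ_[p]
  sgn_mul_self : ∀ s, sgn s * sgn s = 1
  exponent_congr : ∀ s a a', (∀ t < s, a t = a' t) → exponent s a = exponent s a'
  rest_congr : ∀ s a a' X X', (∀ t < s, a t = a' t) → (∀ t < s, X t = X' t) →
    rest s a X = rest s a' X'

namespace TriangularSystem

variable {p : ℕ} [Fact p.Prime] {ι : Type*} [LinearOrder ι] (T : TriangularSystem p ι)

/-- The equation with index `s`. -/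
def SolAt (s : ι) (a X : ι → ℚ_[p]) : Prop :=
  a s = T.sgn s * (p : ℚ_[p]) ^ T.exponent s a * X s + T.rest s a X

/-- `(a, X)` is a solution of the system. -/
def Sol (a X : ι → ℚ_[p]) : Prop := ∀ s, T.SolAt s a X

variable {T} {a a' X X' : ι → ℚ_[p]}

theorem SolAt.congr {s : ι} (h : T.SolAt s a X) (ha : ∀ t ≤ s, a t = a' t)
    (hX : ∀ t ≤ s, X t = X' t) : T.SolAt s a' X' := by
  unfold SolAt at h ⊢
  rw [← ha s le_rfl, ← hX s le_rfl, ← T.exponent_congr s a a' fun t ht => ha t ht.le,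
    ← T.rest_congr s a a' X X' (fun t ht => ha t ht.le) fun t ht => hX t ht.le]
  exact h

theorem Sol.eq_left [WellFoundedLT ι] (h : T.Sol a X) (h' : T.Sol a' X') {s : ι}
    (hX : ∀ t ≤ s, X t = X' t) : a s = a' s := by
  induction s using WellFoundedLT.induction with
  | _ s ih =>
    have hlt : ∀ t < s, a t = a' t := fun t ht => ih t ht fun r hr => hX r (hr.trans ht.le)
    rw [h s, h' s, hX s le_rfl, T.exponent_congr s a a' hlt,
      T.rest_congr s a a' X X' hlt fun t ht => hX t ht.le]

theorem coeff_ne_zero (T : TriangularSystem p ι) (s : ι) (a : ι → ℚ_[p]) :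
    T.sgn s * (p : ℚ_[p]) ^ T.exponent s a ≠ 0 :=
  mul_ne_zero (fun h => by simpa [h] using T.sgn_mul_self s) (pow_ne_zero _ (p_ne_zero p))

theorem Sol.eq_right [WellFoundedLT ι] (h : T.Sol a X) (h' : T.Sol a' X') {s : ι}
    (ha : ∀ t ≤ s, a t = a' t) : X s = X' s := by
  induction s using WellFoundedLT.induction with
  | _ s ih =>
    have hlt : ∀ t < s, X t = X' t := fun t ht => ih t ht fun r hr => ha r (hr.trans ht.le)
    have h1 := h s
    have h2 := h' s
    unfold SolAt at h1 h2
    rw [← ha s le_rfl, ← T.exponent_congr s a a' fun t ht => ha t ht.le,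
      ← T.rest_congr s a a' X X' (fun t ht => ha t ht.le) hlt] at h2
    exact mul_left_cancel₀ (T.coeff_ne_zero s a) (add_right_cancel (h1.symm.trans h2))

theorem exists_sol_left [Fintype ι] (T : TriangularSystem p ι) (X : ι → ℚ_[p]) :
    ∃ a, T.Sol a X := by
  suffices ∀ S : Finset ι, ∃ a, ∀ s ∈ S, T.SolAt s a X by
    obtain ⟨a, ha⟩ := this Finset.univ
    exact ⟨a, fun s => ha s (Finset.mem_univ s)⟩
  intro S
  -- Indices are added in increasing order, so solving the newest equation does not disturb those
  -- already solved.
  induction S using Finset.induction_on_max with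
  | empty => exact ⟨0, by simp⟩
  | insert s S hs ih =>
    obtain ⟨a, ha⟩ := ih
    set v := T.sgn s * (p : ℚ_[p]) ^ T.exponent s a * X s + T.rest s a X with hv
    have hlt : ∀ t < s, a t = Function.update a s v t := fun t ht => by
      rw [Function.update_of_ne ht.ne]
    refine ⟨Function.update a s v, fun t ht => ?_⟩
    rcases Finset.mem_insert.mp ht with rfl | ht
    · unfold SolAt
      rw [Function.update_self, ← T.exponent_congr t _ _ hlt,
        ← T.rest_congr t _ _ X X hlt fun _ _ => rfl]
    · exact (ha t ht).congr (fun r hr => hlt r (hr.trans_lt (hs t ht))) fun _ _ => rfl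

theorem exists_sol_right [Fintype ι] (T : TriangularSystem p ι) (a : ι → ℚ_[p]) :
    ∃ X, T.Sol a X := by
  suffices ∀ S : Finset ι, ∃ X, ∀ s ∈ S, T.SolAt s a X by
    obtain ⟨X, hX⟩ := this Finset.univ
    exact ⟨X, fun s => hX s (Finset.mem_univ s)⟩
  intro S
  induction S using Finset.induction_on_max with
  | empty => exact ⟨0, by simp⟩
  | insert s S hs ih =>
    obtain ⟨X, hX⟩ := ih
    set v := (T.sgn s * (p : ℚ_[p]) ^ T.exponent s a)⁻¹ * (a s - T.rest s a X) with hv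
    have hlt : ∀ t < s, X t = Function.update X s v t := fun t ht => by
      rw [Function.update_of_ne ht.ne]
    refine ⟨Function.update X s v, fun t ht => ?_⟩
    rcases Finset.mem_insert.mp ht with rfl | ht
    · unfold SolAt
      rw [Function.update_self, ← T.rest_congr t a a _ _ (fun _ _ => rfl) hlt, hv,
        mul_inv_cancel_left₀ (T.coeff_ne_zero t a), sub_add_cancel]
    · exact (hX t ht).congr (fun _ _ => rfl) fun r hr => hlt r (hr.trans_lt (hs t ht))

/-- Translating `X` by integral vectors does not change the `μ(a_s)`. -/
def MuInvariant (T : TriangularSystem p ι) : Prop :=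
  ∀ a a' X X', T.Sol a X → T.Sol a' X' → (∀ s, ‖X' s - X s‖ ≤ 1) → ∀ s, mu (a' s) = mu (a s)

/-- The entries are normalised in increasing order. Adjusting X_s integrally moves b_s p^μ within
its class modulo p^{e_s+μ} and affects only later entries; `MuInvariant` keeps all the μ, hence the
moduli, unchanged. -/
theorem exists_representative [Fintype ι] (hT : T.MuInvariant) (h : T.Sol a X) :
    ∃ (b Z : ι → ℚ_[p]) (c : ι → ℤ), T.Sol b Z ∧ (∀ s, ‖Z s - X s‖ ≤ 1) ∧
      ∀ s, 0 ≤ c s ∧ c s < (p : ℤ) ^ (T.exponent s b + mu (b s)) ∧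
        b s = (c s : ℚ_[p]) * (p : ℚ_[p]) ^ (-(mu (b s) : ℤ)) := by
  suffices ∀ S : Finset ι, ∃ (b Z : ι → ℚ_[p]), T.Sol b Z ∧ (∀ s, ‖Z s - X s‖ ≤ 1) ∧
      ∀ s ∈ S, ∃ c : ℤ, 0 ≤ c ∧ c < (p : ℤ) ^ (T.exponent s b + mu (b s)) ∧
        b s = (c : ℚ_[p]) * (p : ℚ_[p]) ^ (-(mu (b s) : ℤ)) by
    obtain ⟨b, Z, h1, h2, h3⟩ := this Finset.univ
    choose c hc using fun s => h3 s (Finset.mem_univ s)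
    exact ⟨b, Z, c, h1, h2, hc⟩
  intro S
  induction S using Finset.induction_on_max with
  | empty => exact ⟨a, X, h, by simp, by simp⟩
  | insert s S hs ih =>
    obtain ⟨b, Z, h1, h2, h3⟩ := ih
    set M := T.exponent s b + mu (b s) with hM
    set u : ℤ_[p] := ⟨b s * (p : ℚ_[p]) ^ mu (b s), norm_mul_pow_mu_le _⟩ with hu
    -- The truncation of u modulo p^M is the desired integer, and z is the integral error to be
    -- absorbed by X_s.
    obtain ⟨z, hz⟩ := Ideal.mem_span_singleton'.mp (PadicInt.appr_spec M u)
    have hz' : b s * (p : ℚ_[p]) ^ mu (b s) - (u.appr M : ℚ_[p]) = z * (p : ℚ_[p]) ^ M := by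
      have := congrArg (fun x : ℤ_[p] => (x : ℚ_[p])) hz.symm
      push_cast at this
      exact this
    have hsgn : ‖T.sgn s‖ = 1 := by
      have := congrArg norm (T.sgn_mul_self s)
      rw [norm_mul, norm_one] at this
      nlinarith [norm_nonneg (T.sgn s)]
    -- Since the sign squares to 1, this shift changes b_s by exactly -p^{e_s} z.
    set Z' := Function.update Z s (Z s - T.sgn s * z) with hZ'
    have hZlt : ∀ t < s, Z t = Z' t := fun t ht => by rw [hZ', Function.update_of_ne ht.ne]
    obtain ⟨b', hb'⟩ := T.exists_sol_left Z'
    have hlt : ∀ t < s, b t = b' t := fun t ht =>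
      h1.eq_left hb' fun r hr => hZlt r (hr.trans_lt ht)
    have hdiff : ∀ t, ‖Z' t - Z t‖ ≤ 1 := fun t => by
      by_cases hts : t = s
      · subst hts
        rw [hZ', Function.update_self, sub_sub_cancel_left, norm_neg, norm_mul, hsgn, one_mul]
        exact z.norm_le_one
      · rw [hZ', Function.update_of_ne hts, sub_self, norm_zero]
        exact zero_le_one
    have hmu := hT b b' Z Z' h1 hb' hdiff
    refine ⟨b', Z', hb', fun t => ?_, fun t ht => ?_⟩
    · rw [← sub_add_sub_cancel _ (Z t)]
      exact (IsUltrametricDist.norm_add_le_max _ _).trans (max_le (hdiff t) (h2 t))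
    · rw [hmu t]
      rcases Finset.mem_insert.mp ht with rfl | ht
      · rw [← T.exponent_congr t _ _ hlt]
        refine ⟨u.appr M, by positivity, by exact_mod_cast u.appr_lt M, ?_⟩
        have e1 : b' t = b t - (p : ℚ_[p]) ^ T.exponent t b * z := by
          have e2 := hb' t
          have e3 := h1 t
          unfold SolAt at e2 e3
          rw [← T.exponent_congr t _ _ hlt, ← T.rest_congr t _ _ _ _ hlt hZlt, hZ',
            Function.update_self] at e2
          linear_combination e2 - e3 -
            (p : ℚ_[p]) ^ T.exponent t b * z * T.sgn_mul_self t
        have hp := pow_ne_zero (mu (b t)) (p_ne_zero p)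
        rw [hM, pow_add] at hz'
        rw [e1, _root_.zpow_neg, zpow_natCast, eq_mul_inv_iff_mul_eq₀ hp]
        push_cast
        linear_combination hz'
      · obtain ⟨c, hc⟩ := h3 t ht
        refine ⟨c, ?_⟩
        rwa [← T.exponent_congr t _ _ fun r hr => hlt r (hr.trans (hs t ht)), ← hlt t (hs t ht)]

theorem int_eq_of_norm_sub_le {M : ℕ} {c c' : ℤ} (h0 : 0 ≤ c) (h1 : c < (p : ℤ) ^ M)
    (h0' : 0 ≤ c') (h1' : c' < (p : ℤ) ^ M) {z : ℚ_[p]} (hz : ‖z‖ ≤ 1)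
    (h : (c' : ℚ_[p]) - c = (p : ℚ_[p]) ^ M * z) : c = c' := by
  have h2 : ‖((c' - c : ℤ) : ℚ_[p])‖ ≤ (p : ℝ) ^ (-(M : ℤ)) := by
    push_cast
    rw [h, norm_mul, ← zpow_natCast, Padic.norm_p_zpow]
    exact mul_le_of_le_one_right (by positivity) hz
  rw [Padic.norm_int_le_pow_iff_dvd] at h2
  have h3 : c ≡ c' [ZMOD (p : ℤ) ^ M] := Int.modEq_iff_dvd.mpr (by exact_mod_cast h2)
  rw [Int.ModEq, Int.emod_eq_of_lt h0 h1, Int.emod_eq_of_lt h0' h1'] at h3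
  exact h3

/-- If the earlier entries agree, so do the earlier X, hence the exponents and remainders at s. Then
c'_s - c_s is p^{e_s+m_s} times an integral number, and both lie in [0, p^{e_s+m_s}). -/
theorem representative_unique [WellFoundedLT ι] (h : T.Sol a X) (h' : T.Sol a' X')
    (hX : ∀ s, ‖X' s - X s‖ ≤ 1) {m : ι → ℕ} {c c' : ι → ℤ}
    (hc : ∀ s, 0 ≤ c s ∧ c s < (p : ℤ) ^ (T.exponent s a + m s) ∧
      a s = (c s : ℚ_[p]) * (p : ℚ_[p]) ^ (-(m s : ℤ)))
    (hc' : ∀ s, 0 ≤ c' s ∧ c' s < (p : ℤ) ^ (T.exponent s a' + m s) ∧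
      a' s = (c' s : ℚ_[p]) * (p : ℚ_[p]) ^ (-(m s : ℤ))) (s : ι) : c s = c' s := by
  induction s using WellFoundedLT.induction with
  | _ s ih =>
    have hlt : ∀ t < s, a t = a' t := fun t ht => by rw [(hc t).2.2, (hc' t).2.2, ih t ht]
    have hXlt : ∀ t < s, X t = X' t := fun t ht =>
      h.eq_right h' fun r hr => hlt r (hr.trans_lt ht)
    have e := h s
    have e' := h' s
    have b' := (hc' s).2.1
    unfold SolAt at e e'
    rw [← T.exponent_congr s _ _ hlt] at b' e'
    rw [← T.rest_congr s _ _ _ _ hlt hXlt, (hc' s).2.2, _root_.zpow_neg, zpow_natCast] at e'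
    rw [(hc s).2.2, _root_.zpow_neg, zpow_natCast] at e
    have hp := pow_ne_zero (m s) (p_ne_zero p)
    have hsgn : ‖T.sgn s‖ = 1 := by
      have := congrArg norm (T.sgn_mul_self s)
      rw [norm_mul, norm_one] at this
      nlinarith [norm_nonneg (T.sgn s)]
    refine int_eq_of_norm_sub_le (hc s).1 (hc s).2.1 (hc' s).1 b'
      (z := T.sgn s * (X' s - X s)) (by rw [norm_mul, hsgn, one_mul]; exact hX s) ?_
    rw [pow_add]
    field_simp at e e'
    linear_combination e' - e

end TriangularSystem

/-! ### Partial products of rows and the equations for the coordinates. -/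

section PartProd

/-- The product of the rows of `b(a)` with (0-based) index smaller than `x`. -/
def partProd (hkn : k ≤ n) (a : Family n k ℚ_[p]) (x : ℕ) : GL (Fin (n + 1)) ℚ_[p] :=
  (((List.finRange k).take x).reverse.map fun i =>
    rowProd i.val (by have := i.isLt; omega) (a i)).prod

variable (hkn : k ≤ n) (a : Family n k ℚ_[p])

theorem partProd_zero : partProd hkn a 0 = 1 := by simp [partProd]

theorem partProd_succ {x : ℕ} (h : x < k) :
    partProd hkn a (x + 1) =
      rowProd x (by omega) (a ⟨x, h⟩) * partProd hkn a x := by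
  have h' : x < (List.finRange k).length := by simpa using h
  rw [partProd, List.take_succ_eq_append_getElem h', List.reverse_append, List.map_append,
    List.prod_append]
  simp [partProd]

theorem partProd_eq_bMap : partProd hkn a k = bMap a := by
  rw [partProd, List.take_of_length_le (by simp)]
  rfl

theorem partProd_congr {a a' : Family n k ℚ_[p]} {x : ℕ} (hx : x ≤ k)
    (h : ∀ i : Fin k, i.val < x → a i = a' i) : partProd hkn a x = partProd hkn a' x := by
  induction x with
  | zero => rw [partProd_zero, partProd_zero]
  | succ x ih =>
    rw [partProd_succ hkn a hx, partProd_succ hkn a' hx, h ⟨x, hx⟩ (Nat.lt_succ_self x),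
      ih (by omega) fun i hi => h i (by omega)]

/-- The sum of the `μ(a_{l,j})` over the (0-based) rows `l < x`. -/
def colExp (a : Family n k ℚ_[p]) (x : ℕ) (j : Fin (n + 1 - k)) : ℕ :=
  ∑ l : Fin k, if l.val < x then mu (a l j) else 0

theorem colExp_succ {x : ℕ} (h : x < k) (j : Fin (n + 1 - k)) :
    colExp a (x + 1) j = colExp a x j + mu (a ⟨x, h⟩ j) := by
  have : mu (a ⟨x, h⟩ j) = ∑ l : Fin k, if l = ⟨x, h⟩ then mu (a l j) else 0 := by simp
  rw [colExp, colExp, this, ← Finset.sum_add_distrib]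
  refine Finset.sum_congr rfl fun l _ => ?_
  simp only [Fin.ext_iff]
  split_ifs <;> omega

theorem partProd_stdVec_of_le {x y : ℕ} (hx : x ≤ k) (hy : x + (n + 1 - k) ≤ y) :
    (partProd hkn a x).val *ᵥ stdVec (n + 1) ℚ_[p] y = stdVec (n + 1) ℚ_[p] y := by
  induction x with
  | zero => simp [partProd_zero]
  | succ x ih =>
    rw [partProd_succ hkn a hx, Units.val_mul, ← Matrix.mulVec_mulVec, ih (by omega) (by omega),
      rowProd_stdVec_of_ne _ _ _ (by omega)]

theorem rowProd_mem_flag {q i y : ℕ} (h : i + q ≤ n) (b : Fin q → ℚ_[p]) (hy : y ≤ i + q)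
    {v : Fin (n + 1) → ℚ_[p]} (hv : v ∈ flag (n + 1) ℚ_[p] y) :
    (rowProd i h b).val *ᵥ v ∈ flag (n + 1) ℚ_[p] (y + 1) := by
  refine mulVec_mem_of_flag (fun z hz _ => ?_) hv
  rcases lt_or_ge z i with hzi | hzi
  · rw [rowProd_stdVec_of_ne _ _ _ (Or.inl hzi)]
    exact stdVec_mem_flag (by omega)
  · obtain ⟨j, rfl⟩ := Nat.exists_eq_add_of_le hzi
    exact (rowProd_leads i h b ⟨j, by omega⟩).mem_flag (by simp only; omega)

/-- Each row moves the leading basis vector up by one and multiplies its coefficient by p^μ. The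
lower terms also rise by at most one step, so they stay below it. -/
theorem partProd_leads {x : ℕ} (hx : x ≤ k) (j : Fin (n + 1 - k)) :
    Leads ((partProd hkn a x).val *ᵥ stdVec (n + 1) ℚ_[p] j.val)
      ((p : ℚ_[p]) ^ colExp a x j) (x + j.val) := by
  induction x with
  | zero => simp [partProd_zero, colExp, Leads]
  | succ x ih =>
    have h1 := rowProd_leads (n := n) x (by omega) (a ⟨x, hx⟩) j
    have h2 := rowProd_mem_flag (n := n) (i := x) (by omega) (a ⟨x, hx⟩) (by have := j.isLt; omega)
      (ih (by omega))
    have h3 := Submodule.smul_mem _ ((p : ℚ_[p]) ^ colExp a x j) h1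
    rw [partProd_succ hkn a hx, Units.val_mul, ← Matrix.mulVec_mulVec, colExp_succ _ hx,
      show x + 1 + j.val = x + j.val + 1 by omega]
    unfold Leads
    convert add_mem h2 h3 using 1
    rw [Matrix.mulVec_sub, Matrix.mulVec_smul, smul_sub, smul_smul, pow_add]
    abel

/-- The families `X` such that `b(a)` lies in `B w y(X)`, with `B` upper triangular and `y(X)` the
element of `U_w` with coordinates `X`; see `isTri_bMap`. -/
def IsCoord (a X : Family n k ℚ_[p]) : Prop :=
  ∀ (i : Fin k) (j : Fin (n + 1 - k)),
    ∑ l, X i l * ((partProd hkn a i.val).val *ᵥ stdVec (n + 1) ℚ_[p] l.val)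
      ⟨i.val + j.val, by have := i.isLt; have := j.isLt; omega⟩ = rowVec (a i) j

/-- By `IsCoord`, the rows before i bring the vector to the one that row i collapses onto e_i, up to
an error in the span of the first i basis vectors. Row i and all later rows fix such errors. -/
theorem partProd_rowVec {a X : Family n k ℚ_[p]} (hX : IsCoord hkn a X) {x : ℕ} (hx : x ≤ k)
    (i : Fin k) (hi : i.val < x) :
    Leads ((partProd hkn a x).val *ᵥ (stdVec (n + 1) ℚ_[p] (n + 1 - k + i.val) -
      ∑ j, X i j • stdVec (n + 1) ℚ_[p] j.val))
      ((-1) ^ (n + 1 - k) * ((p : ℚ_[p]) ^ ∑ j, mu (a i j))⁻¹) i.val := by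
  induction x with
  | zero => omega
  | succ x ih =>
    rw [partProd_succ hkn a hx, Units.val_mul, ← Matrix.mulVec_mulVec]
    rcases (Nat.lt_succ_iff_lt_or_eq.mp hi) with hlt | rfl
    · have h1 := ih (by omega) hlt
      have h2 : ∀ v ∈ flag (n + 1) ℚ_[p] x,
          (rowProd x (by omega) (a ⟨x, hx⟩)).val *ᵥ v = v := fun v hv => by
        conv_rhs => rw [← Matrix.one_mulVec v]
        refine mulVec_eq_of_flag (fun z hz => ?_) hv
        rw [Matrix.one_mulVec, rowProd_stdVec_of_ne _ _ _ (Or.inl hz)]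
      rw [h2 _ (h1.mem_flag hlt)]
      exact h1
    · have h1 := partProd_stdVec_of_le hkn a (x := i.val) (y := n + 1 - k + i.val) (by omega)
        (by omega)
      have h2 := rowProd_rowVec (n := n) i.val (by omega) (a i)
      -- The error after the rows before i; the equations of `IsCoord` say that its components in
      -- positions i, …, i+q-1 vanish.
      set r := ∑ j, rowVec (a i) j • stdVec (n + 1) ℚ_[p] (i.val + j.val) -
        ∑ j, X i j • ((partProd hkn a i.val).val *ᵥ stdVec (n + 1) ℚ_[p] j.val) with hr
      have h3 : r ∈ flag (n + 1) ℚ_[p] i.val := by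
        intro z hz
        rw [hr, Pi.sub_apply, Finset.sum_apply, Finset.sum_apply, sub_eq_zero]
        simp only [Pi.smul_apply, smul_eq_mul]
        obtain ⟨j, hj⟩ := Nat.exists_eq_add_of_le hz
        by_cases hjq : j < n + 1 - k
        · have h6 := hX i ⟨j, hjq⟩
          have h7 : (⟨i.val + (⟨j, hjq⟩ : Fin (n + 1 - k)).val, by simp only; omega⟩ :
            Fin (n + 1)) = z := Fin.ext hj.symm
          rw [h7] at h6
          rw [h6, Finset.sum_eq_single ⟨j, hjq⟩]
          · simp [stdVec, hj]
          · intro l _ hl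
            have : j ≠ l.val := fun h => hl (Fin.ext h.symm)
            simp [stdVec, this, hj]
          · simp
        -- Positions from i+q on are out of reach of all the vectors involved.
        · rw [Finset.sum_eq_zero, Finset.sum_eq_zero]
          · intro l _
            have := l.isLt
            rw [((partProd_leads hkn a (x := i.val) (by omega) l).mem_flag
              (Nat.lt_succ_self _)) z (by omega), mul_zero]
          · intro l _
            have := l.isLt
            have : z.val ≠ i.val + l.val := by omega
            simp [stdVec, this]
      have h4 : (partProd hkn a i.val).val *ᵥ (stdVec (n + 1) ℚ_[p] (n + 1 - k + i.val) -
          ∑ j, X i j • stdVec (n + 1) ℚ_[p] j.val) =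
          (stdVec (n + 1) ℚ_[p] (i.val + (n + 1 - k)) -
            ∑ j, rowVec (a i) j • stdVec (n + 1) ℚ_[p] (i.val + j.val)) + r := by
        rw [Matrix.mulVec_sub, h1, Matrix.mulVec_sum, hr, add_comm (n + 1 - k)]
        simp only [Matrix.mulVec_smul]
        abel
      have h5 : (rowProd i.val (by omega) (a i)).val *ᵥ r = r := by
        conv_rhs => rw [← Matrix.one_mulVec r]
        refine mulVec_eq_of_flag (fun z hz => ?_) h3
        rw [Matrix.one_mulVec, rowProd_stdVec_of_ne _ _ _ (Or.inl hz)]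
      rw [h4, Matrix.mulVec_add, h5, h2, Leads, add_sub_cancel_left]
      exact h3

end PartProd

/-! ### The coordinate equations as a triangular system. -/

section System

/-- The index pairs, ordered in such a way that the equations for the coordinates become
triangular. -/
abbrev Pos (n k : ℕ) : Type := Fin k ×ₗ (Fin (n + 1 - k))ᵒᵈ

/-- The position with index `(i, j)`. -/
def pos (i : Fin k) (j : Fin (n + 1 - k)) : Pos n k := toLex (i, OrderDual.toDual j)

/-- Families as functions on positions. -/
def famEquiv (n k : ℕ) (α : Type*) : Family n k α ≃ (Pos n k → α) where
  toFun a s := a (ofLex s).1 (OrderDual.ofDual (ofLex s).2)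
  invFun a i j := a (pos i j)
  left_inv _ := rfl
  right_inv _ := rfl

theorem famEquiv_pos {α : Type*} (a : Family n k α) (i : Fin k) (j : Fin (n + 1 - k)) :
    famEquiv n k α a (pos i j) = a i j := rfl

theorem exists_pos (s : Pos n k) : ∃ i j, s = pos i j :=
  ⟨(ofLex s).1, OrderDual.ofDual (ofLex s).2, rfl⟩

theorem pos_lt_pos {i i' : Fin k} {j j' : Fin (n + 1 - k)} :
    (pos i j : Pos n k) < pos i' j' ↔ i < i' ∨ i = i' ∧ j' < j := by
  rw [pos, pos, Prod.Lex.toLex_lt_toLex]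
  rfl

theorem colExp_eq (a : Family n k ℚ_[p]) (i : Fin k) (j : Fin (n + 1 - k)) :
    colExp a i.val j = ∑ l ∈ Finset.Iio i, mu (a l j) := by
  rw [colExp, ← Finset.filter_gt_eq_Iio, Finset.sum_filter]
  rfl

/-- The equations between `a` and its coordinates. -/
def coordSystem (p : ℕ) [Fact p.Prime] (hkn : k ≤ n) : TriangularSystem p (Pos n k) where
  exponent s a := ∑ l ∈ Finset.Iio (ofLex s).1,
      mu ((famEquiv n k _).symm a l (OrderDual.ofDual (ofLex s).2)) +
    ∑ l ∈ Finset.Ioi (OrderDual.ofDual (ofLex s).2), mu ((famEquiv n k _).symm a (ofLex s).1 l)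
  sgn s := (-1) ^ (n + 1 - k - 1 - (OrderDual.ofDual (ofLex s).2).val)
  rest s a X := (-1) ^ (n + 1 - k - 1 - (OrderDual.ofDual (ofLex s).2).val) *
    (p : ℚ_[p]) ^ (∑ l ∈ Finset.Ioi (OrderDual.ofDual (ofLex s).2),
      mu ((famEquiv n k _).symm a (ofLex s).1 l)) *
    ∑ l ∈ Finset.Ioi (OrderDual.ofDual (ofLex s).2), (famEquiv n k _).symm X (ofLex s).1 l *
      ((partProd hkn ((famEquiv n k _).symm a) (ofLex s).1.val).val *ᵥ
        stdVec (n + 1) ℚ_[p] l.val)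
      ⟨(ofLex s).1.val + (OrderDual.ofDual (ofLex s).2).val, by
        have := (ofLex s).1.isLt; have := (OrderDual.ofDual (ofLex s).2).isLt; omega⟩
  sgn_mul_self s := by rw [← mul_pow]; simp
  exponent_congr s a a' h := by
    obtain ⟨i, j, rfl⟩ := exists_pos s
    refine congrArg₂ _ (Finset.sum_congr rfl fun l hl => ?_) (Finset.sum_congr rfl fun l hl => ?_)
    · exact congrArg mu (h (pos l j) (pos_lt_pos.mpr (Or.inl (Finset.mem_Iio.mp hl))))
    · exact congrArg mu (h (pos i l) (pos_lt_pos.mpr (Or.inr ⟨rfl, Finset.mem_Ioi.mp hl⟩)))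
  rest_congr s a a' X X' h hX := by
    obtain ⟨i, j, rfl⟩ := exists_pos s
    have h1 : partProd hkn ((famEquiv n k _).symm a) i.val =
        partProd hkn ((famEquiv n k _).symm a') i.val :=
      partProd_congr hkn i.isLt.le fun l hl => funext fun j' =>
        h (pos l j') (pos_lt_pos.mpr (Or.inl hl))
    refine congrArg₂ _ (congrArg₂ _ rfl (congrArg _ (Finset.sum_congr rfl fun l hl => ?_)))
      (Finset.sum_congr rfl fun l hl => congrArg₂ _ ?_ ?_)
    · exact congrArg mu (h (pos i l) (pos_lt_pos.mpr (Or.inr ⟨rfl, Finset.mem_Ioi.mp hl⟩)))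
    · exact hX (pos i l) (pos_lt_pos.mpr (Or.inr ⟨rfl, Finset.mem_Ioi.mp hl⟩))
    · exact congrArg (fun g : GL (Fin (n + 1)) ℚ_[p] =>
        (g.val *ᵥ stdVec (n + 1) ℚ_[p] l.val) _) h1

/-- Adding μ(a_{i,j}) gives M_{i,j}; this is the source of the bound p^{M_{i,j}} in C_w(m). -/
theorem coordSystem_exponent (hkn : k ≤ n) (a : Family n k ℚ_[p]) (i : Fin k)
    (j : Fin (n + 1 - k)) :
    (coordSystem p hkn).exponent (pos i j) (famEquiv n k _ a) =
      ∑ l ∈ Finset.Iio i, mu (a l j) + ∑ l ∈ Finset.Ioi j, mu (a i l) := rfl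

/-- The image of e_l leads at i+l, so in position i+j the terms l < j vanish and l = j contributes a
pure power of p. Clearing the sign and the denominator of `rowVec` solves the equation for a_{i,j}.
-/
theorem coordSystem_solAt (hkn : k ≤ n) (a X : Family n k ℚ_[p]) (i : Fin k)
    (j : Fin (n + 1 - k)) :
    (coordSystem p hkn).SolAt (pos i j) (famEquiv n k _ a) (famEquiv n k _ X) ↔
      ∑ l, X i l * ((partProd hkn a i.val).val *ᵥ stdVec (n + 1) ℚ_[p] l.val)
        ⟨i.val + j.val, by have := i.isLt; have := j.isLt; omega⟩ = rowVec (a i) j := by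
  set z : Fin (n + 1) := ⟨i.val + j.val, by have := i.isLt; have := j.isLt; omega⟩ with hz
  set R : Fin (n + 1 - k) → ℚ_[p] := fun l =>
    ((partProd hkn a i.val).val *ᵥ stdVec (n + 1) ℚ_[p] l.val) z with hR
  have h1 : ∀ l < j, R l = 0 := fun l hl =>
    (partProd_leads hkn a i.isLt.le l).mem_flag (Nat.lt_succ_self _) z
      (by simp only [hz]; have : l.val < j.val := hl; omega)
  have h2 : R j = (p : ℚ_[p]) ^ colExp a i.val j :=
    (partProd_leads hkn a i.isLt.le j).apply (y := z)
  have h3 : ∑ l, X i l * R l =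
      (p : ℚ_[p]) ^ colExp a i.val j * X i j + ∑ l ∈ Finset.Ioi j, X i l * R l := by
    have e : ∑ l, X i l * R l = ∑ l ∈ Finset.Ici j, X i l * R l := by
      symm
      refine Finset.sum_subset (Finset.subset_univ _) fun l _ hl => ?_
      rw [h1 l (by simpa using hl), mul_zero]
    rw [e, ← Finset.Ioi_insert, Finset.sum_insert (by simp), h2, mul_comm]
  have hs : ((-1 : ℚ_[p]) ^ (n + 1 - k - 1 - j.val)) * (-1) ^ (n + 1 - k - 1 - j.val) = 1 := by
    rw [← mul_pow]; simp
  have hp : (p : ℚ_[p]) ^ (∑ l ∈ Finset.Ioi j, mu (a i l)) ≠ 0 := pow_ne_zero _ (p_ne_zero p)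
  change a i j = (-1) ^ (n + 1 - k - 1 - j.val) *
      (p : ℚ_[p]) ^ (∑ l ∈ Finset.Iio i, mu (a l j) + ∑ l ∈ Finset.Ioi j, mu (a i l)) * X i j +
    (-1) ^ (n + 1 - k - 1 - j.val) * (p : ℚ_[p]) ^ (∑ l ∈ Finset.Ioi j, mu (a i l)) *
      ∑ l ∈ Finset.Ioi j, X i l * R l ↔ ∑ l, X i l * R l = rowVec (a i) j
  rw [h3, rowVec, colExp_eq, pow_add]
  generalize ((-1 : ℚ_[p]) ^ (n + 1 - k - 1 - j.val)) = ε at hs ⊢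
  constructor
  · intro h
    rw [h]
    field_simp
    linear_combination -((p : ℚ_[p]) ^ (∑ l ∈ Finset.Iio i, mu (a l j)) * X i j +
      ∑ l ∈ Finset.Ioi j, X i l * R l) * hs
  · intro h
    have h' := congrArg (fun t => ε * (p : ℚ_[p]) ^ (∑ l ∈ Finset.Ioi j, mu (a i l)) * t) h
    field_simp at h'
    linear_combination -h' - a i j * hs

theorem coordSystem_sol (hkn : k ≤ n) {a X : Family n k ℚ_[p]} :
    (coordSystem p hkn).Sol (famEquiv n k _ a) (famEquiv n k _ X) ↔ IsCoord hkn a X := by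
  constructor
  · exact fun h i j => (coordSystem_solAt hkn a X i j).mp (h (pos i j))
  · intro h s
    obtain ⟨i, j, rfl⟩ := exists_pos s
    exact (coordSystem_solAt hkn a X i j).mpr (h i j)

theorem exists_isCoord_left (hkn : k ≤ n) (X : Family n k ℚ_[p]) : ∃ a, IsCoord hkn a X := by
  obtain ⟨a, ha⟩ := (coordSystem p hkn).exists_sol_left (famEquiv n k _ X)
  exact ⟨(famEquiv n k _).symm a, (coordSystem_sol hkn).mp (by simpa using ha)⟩

theorem exists_isCoord_right (hkn : k ≤ n) (a : Family n k ℚ_[p]) : ∃ X, IsCoord hkn a X := by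
  obtain ⟨X, hX⟩ := (coordSystem p hkn).exists_sol_right (famEquiv n k _ a)
  exact ⟨(famEquiv n k _).symm X, (coordSystem_sol hkn).mp (by simpa using hX)⟩

theorem IsCoord.eq_left {hkn : k ≤ n} {a a' X : Family n k ℚ_[p]} (h : IsCoord hkn a X)
    (h' : IsCoord hkn a' X) : a = a' := by
  refine (famEquiv n k _).injective (funext fun s => ?_)
  exact ((coordSystem_sol hkn).mpr h).eq_left ((coordSystem_sol hkn).mpr h') fun _ _ => rfl

theorem IsCoord.eq_right {hkn : k ≤ n} {a X X' : Family n k ℚ_[p]} (h : IsCoord hkn a X)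
    (h' : IsCoord hkn a X') : X = X' := by
  refine (famEquiv n k _).injective (funext fun s => ?_)
  exact ((coordSystem_sol hkn).mpr h).eq_right ((coordSystem_sol hkn).mpr h') fun _ _ => rfl

end System

/-! ### The group U_w in block form and conjugation by w. -/

section Weyl

variable {n k : ℕ} {K : Type*} [Field K]

/-- The matrix with the block form `[[1, X], [0, 1]]`, whose lower right block has size `k`. -/
def blockUnipMatrix (X : Family n k K) : Matrix (Fin (n + 1)) (Fin (n + 1)) K :=
  Matrix.of fun x y =>
    if h : x.val < n + 1 - k ∧ n + 1 - k ≤ y.val then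
      X ⟨y.val - (n + 1 - k), by have := y.isLt; omega⟩ ⟨x.val, h.1⟩
    else if x = y then 1 else 0

theorem blockUnipMatrix_apply (X : Family n k K) {x y : Fin (n + 1)}
    (h : x.val < n + 1 - k ∧ n + 1 - k ≤ y.val) :
    blockUnipMatrix X x y =
      X ⟨y.val - (n + 1 - k), by have := y.isLt; omega⟩ ⟨x.val, h.1⟩ := dif_pos h

theorem blockUnipMatrix_apply_of_not (X : Family n k K) {x y : Fin (n + 1)}
    (h : ¬ (x.val < n + 1 - k ∧ n + 1 - k ≤ y.val)) :
    blockUnipMatrix X x y = if x = y then 1 else 0 := dif_neg h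

theorem blockUnipMatrix_stdVec_of_lt (X : Family n k K) {y : ℕ} (hy : y < n + 1 - k) :
    blockUnipMatrix X *ᵥ stdVec (n + 1) K y = stdVec (n + 1) K y := by
  ext x
  have h := mulVec_stdVec (blockUnipMatrix X) x (⟨y, by omega⟩ : Fin (n + 1))
  simp only at h
  rw [h, blockUnipMatrix_apply_of_not _ (by simp only; omega)]
  simp [stdVec, Fin.ext_iff]

theorem blockUnipMatrix_stdVec (hk : k ≤ n) (X : Family n k K) (i : Fin k) :
    blockUnipMatrix X *ᵥ stdVec (n + 1) K (n + 1 - k + i.val) =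
      stdVec (n + 1) K (n + 1 - k + i.val) + ∑ j, X i j • stdVec (n + 1) K j.val := by
  ext x
  have h := mulVec_stdVec (blockUnipMatrix X) x
    (⟨n + 1 - k + i.val, by have := i.isLt; omega⟩ : Fin (n + 1))
  simp only at h
  rw [h, Pi.add_apply, Finset.sum_apply]
  by_cases hx : x.val < n + 1 - k
  · have h1 : x.val ≠ n + 1 - k + i.val := by omega
    rw [Finset.sum_eq_single ⟨x.val, hx⟩]
    · rw [blockUnipMatrix_apply _ ⟨hx, Nat.le_add_right _ _⟩]
      simp [stdVec, h1]
    · intro j _ hj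
      have : x.val ≠ j.val := fun h => hj (Fin.ext h.symm)
      simp [stdVec, this]
    · simp
  · rw [Finset.sum_eq_zero]
    · rw [blockUnipMatrix_apply_of_not _ fun h => hx h.1]
      simp [stdVec, Fin.ext_iff]
    · intro j _
      have : x.val ≠ j.val := by have := j.isLt; omega
      simp [stdVec, this]

theorem lt_or_exists_eq_add (hk : k ≤ n) {y : ℕ} (hy : y < n + 1) :
    y < n + 1 - k ∨ ∃ i : Fin k, y = n + 1 - k + i.val := by
  rcases lt_or_ge y (n + 1 - k) with h | h
  · exact Or.inl h
  · exact Or.inr ⟨⟨y - (n + 1 - k), by omega⟩, by simp only; omega⟩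

theorem blockUnipMatrix_mul (hk : k ≤ n) (X X' : Family n k K) :
    blockUnipMatrix X * blockUnipMatrix X' = blockUnipMatrix (X + X') := by
  refine ext_stdVec fun y hy => ?_
  rw [← Matrix.mulVec_mulVec]
  rcases lt_or_exists_eq_add hk hy with h | ⟨i, rfl⟩
  · simp only [blockUnipMatrix_stdVec_of_lt _ h]
  · simp only [blockUnipMatrix_stdVec hk, Matrix.mulVec_add, Matrix.mulVec_sum,
      Matrix.mulVec_smul, blockUnipMatrix_stdVec_of_lt _ (Fin.isLt _), Pi.add_apply, add_smul,
      Finset.sum_add_distrib, add_assoc]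

theorem blockUnipMatrix_zero : blockUnipMatrix (0 : Family n k K) = 1 := by
  ext x y
  by_cases h : x.val < n + 1 - k ∧ n + 1 - k ≤ y.val
  · have : x ≠ y := by rintro rfl; omega
    rw [blockUnipMatrix_apply _ h, Matrix.one_apply_ne this]
    rfl
  · rw [blockUnipMatrix_apply_of_not _ h, Matrix.one_apply]

/-- The element of `U_w` with block form `[[1, X], [0, 1]]`. -/
def blockUnip (hk : k ≤ n) (X : Family n k K) : GL (Fin (n + 1)) K :=
  ⟨blockUnipMatrix X, blockUnipMatrix (-X),
    by rw [blockUnipMatrix_mul hk, add_neg_cancel, blockUnipMatrix_zero],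
    by rw [blockUnipMatrix_mul hk, neg_add_cancel, blockUnipMatrix_zero]⟩

theorem blockUnip_mul (hk : k ≤ n) (X X' : Family n k K) :
    blockUnip hk X * blockUnip hk X' = blockUnip hk (X + X') :=
  Units.ext (blockUnipMatrix_mul hk X X')

theorem blockUnip_inv (hk : k ≤ n) (X : Family n k K) :
    (blockUnip hk X)⁻¹ = blockUnip hk (-X) := Units.ext rfl

theorem blockUnip_zero (hk : k ≤ n) : blockUnip hk (0 : Family n k K) = 1 :=
  Units.ext blockUnipMatrix_zero

theorem blockUnip_apply (hk : k ≤ n) (X : Family n k K) (i : Fin k) (j : Fin (n + 1 - k)) :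
    (blockUnip hk X).val ⟨j.val, by have := j.isLt; omega⟩
      ⟨n + 1 - k + i.val, by have := i.isLt; omega⟩ = X i j := by
  simp only [blockUnip]
  rw [blockUnipMatrix_apply _ ⟨j.isLt, Nat.le_add_right _ _⟩]
  simp

theorem blockUnip_injective (hk : k ≤ n) :
    Function.Injective (blockUnip hk : Family n k K → GL (Fin (n + 1)) K) := fun X X' h => by
  ext i j
  rw [← blockUnip_apply hk X, ← blockUnip_apply hk X', h]

theorem weyl_mulVec_of_lt (hk : k ≤ n) (v : Fin (n + 1) → K) {x : Fin (n + 1)} (hx : x.val < k) :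
    ((weyl K n k).val *ᵥ v) x = (-1) ^ (n + 1 - k) * v ⟨n + 1 - k + x.val, by omega⟩ := by
  rw [Matrix.mulVec, dotProduct, Finset.sum_eq_single ⟨n + 1 - k + x.val, by omega⟩]
  · simp [weyl, weylMatrix, hx, add_comm]
  · intro y _ hy
    have : y.val ≠ x.val + (n + 1 - k) := fun h => hy (Fin.ext (by simp only; omega))
    simp [weyl, weylMatrix, hx, this]
  · simp

theorem weyl_mulVec_of_le (v : Fin (n + 1) → K) {x : Fin (n + 1)} (hx : k ≤ x.val) :
    ((weyl K n k).val *ᵥ v) x = v ⟨x.val - k, by omega⟩ := by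
  rw [Matrix.mulVec, dotProduct, Finset.sum_eq_single ⟨x.val - k, by omega⟩]
  · simp [weyl, weylMatrix, hx.not_gt, hx]
  · intro y _ hy
    have : x.val ≠ y.val + k := fun h => hy (Fin.ext (by simp only; omega))
    simp [weyl, weylMatrix, hx.not_gt, this]
  · simp

theorem weyl_stdVec_of_lt (hk : k ≤ n) {y : ℕ} (hy : y < n + 1 - k) :
    (weyl K n k).val *ᵥ stdVec (n + 1) K y = stdVec (n + 1) K (k + y) := by
  ext x
  rcases lt_or_ge x.val k with hx | hx
  · have h1 : n + 1 - k + x.val ≠ y := by omega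
    have h2 : x.val ≠ k + y := by omega
    rw [weyl_mulVec_of_lt hk _ hx]
    simp [stdVec, h1, h2]
  · rw [weyl_mulVec_of_le _ hx]
    have : x.val - k = y ↔ x.val = k + y := by omega
    simp [stdVec, this]

theorem weyl_stdVec (hk : k ≤ n) (i : Fin k) :
    (weyl K n k).val *ᵥ stdVec (n + 1) K (n + 1 - k + i.val) =
      (-1 : K) ^ (n + 1 - k) • stdVec (n + 1) K i.val := by
  ext x
  rcases lt_or_ge x.val k with hx | hx
  · rw [weyl_mulVec_of_lt hk _ hx]
    simp [stdVec]
  · rw [weyl_mulVec_of_le _ hx]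
    have h1 : x.val - k ≠ n + 1 - k + i.val := by have := x.isLt; omega
    have h2 : x.val ≠ i.val := by have := i.isLt; omega
    simp [stdVec, h1, h2]

theorem isTri_blockUnip (hk : k ≤ n) (X : Family n k K) :
    IsTri (blockUnip hk X) (fun _ => 1) := fun y hy => by
  rcases lt_or_exists_eq_add hk hy with h | ⟨i, rfl⟩
  · simp only [blockUnip, blockUnipMatrix_stdVec_of_lt _ h, Leads, one_smul, sub_self]
    exact zero_mem _
  · simp only [blockUnip, blockUnipMatrix_stdVec hk, Leads, one_smul, add_sub_cancel_left]
    exact sum_mem fun j _ => Submodule.smul_mem _ _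
      (stdVec_mem_flag (by have := j.isLt; omega))

theorem neg_one_pow_mul_self (m : ℕ) : ((-1 : K) ^ m) * (-1) ^ m = 1 := by
  rw [← mul_pow]; simp

theorem weyl_conj_mulVec (g : GL (Fin (n + 1)) K) (v : Fin (n + 1) → K) :
    (weyl K n k * g * (weyl K n k)⁻¹).val *ᵥ ((weyl K n k).val *ᵥ v) =
      (weyl K n k).val *ᵥ (g.val *ᵥ v) := by
  rw [Matrix.mulVec_mulVec, Matrix.mulVec_mulVec, ← Units.val_mul, ← Units.val_mul,
    inv_mul_cancel_right]

theorem weyl_conj_apply_add (hk : k ≤ n) (g : GL (Fin (n + 1)) K) (x : Fin (n + 1)) {y : ℕ}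
    (hy : y < n + 1 - k) :
    (weyl K n k * g * (weyl K n k)⁻¹).val x ⟨k + y, by omega⟩ =
      ((weyl K n k).val *ᵥ (g.val *ᵥ stdVec (n + 1) K y)) x := by
  rw [← weyl_conj_mulVec, weyl_stdVec_of_lt hk hy]
  exact (mulVec_stdVec _ x ⟨k + y, by omega⟩).symm

theorem weyl_conj_apply_of_lt (hk : k ≤ n) (g : GL (Fin (n + 1)) K) (x : Fin (n + 1))
    (i : Fin k) :
    (weyl K n k * g * (weyl K n k)⁻¹).val x ⟨i.val, by omega⟩ = (-1) ^ (n + 1 - k) *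
      ((weyl K n k).val *ᵥ (g.val *ᵥ stdVec (n + 1) K (n + 1 - k + i.val))) x := by
  rw [← weyl_conj_mulVec, weyl_stdVec hk, Matrix.mulVec_smul, Pi.smul_apply, smul_eq_mul,
    ← mul_assoc, neg_one_pow_mul_self, one_mul]
  exact (mulVec_stdVec _ x ⟨i.val, by omega⟩).symm

/-- The diagonal blocks of `w g w⁻¹` are those of `g`. -/
theorem weyl_conj_apply_block (hk : k ≤ n) (g : GL (Fin (n + 1)) K) :
    (∀ x y, ∀ hx : x < n + 1 - k, ∀ hy : y < n + 1 - k,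
      (weyl K n k * g * (weyl K n k)⁻¹).val ⟨k + x, by omega⟩ ⟨k + y, by omega⟩ =
        g.val ⟨x, by omega⟩ ⟨y, by omega⟩) ∧
    ∀ x y, ∀ hx : x < k, ∀ hy : y < k,
      (weyl K n k * g * (weyl K n k)⁻¹).val ⟨x, by omega⟩ ⟨y, by omega⟩ =
        g.val ⟨n + 1 - k + x, by omega⟩ ⟨n + 1 - k + y, by omega⟩ := by
  constructor
  · intro x y hx hy
    rw [weyl_conj_apply_add hk g _ hy, weyl_mulVec_of_le _ (by simp)]
    simp only [add_tsub_cancel_left]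
    exact mulVec_stdVec g.val _ ⟨y, by omega⟩
  · intro x y hx hy
    refine (weyl_conj_apply_of_lt hk g _ ⟨y, hy⟩).trans ?_
    rw [weyl_mulVec_of_lt hk _ hx, ← mul_assoc, neg_one_pow_mul_self, one_mul]
    exact mulVec_stdVec g.val _ ⟨n + 1 - k + y, by omega⟩

/-- Conjugation by w exchanges the positions of the diagonal blocks and preserves their entries. In
U_w these blocks are both upper and lower unipotent, hence identities, and only the upper right
block is free. -/
theorem mem_unipW_iff (hk : k ≤ n) {g : GL (Fin (n + 1)) K} :
    g ∈ unipW n k K ↔ ∃ X, g = blockUnip hk X := by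
  have hmem : g ∈ unipW n k K ↔ g ∈ upperUnip (n + 1) K ∧
      weyl K n k * g * (weyl K n k)⁻¹ ∈ lowerUnip (n + 1) K := by
    rw [unipW, Subgroup.mem_inf, Subgroup.mem_map]
    refine and_congr_right fun _ => ⟨?_, fun h => ⟨_, h, ?_⟩⟩
    · rintro ⟨l, hl, rfl⟩
      simpa [mul_assoc] using hl
    · simp [mul_assoc]
  rw [hmem]
  have hlow : ∀ l : GL (Fin (n + 1)) K, l ∈ lowerUnip (n + 1) K ↔
      (∀ x y, y < x → l.val y x = 0) ∧ ∀ x, l.val x x = 1 := fun l => Iff.rfl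
  constructor
  · rintro ⟨⟨hg, hg1⟩, hl⟩
    rw [hlow] at hl
    refine ⟨fun i j => g.val ⟨j.val, by have := j.isLt; omega⟩
      ⟨n + 1 - k + i.val, by have := i.isLt; omega⟩, Units.ext ?_⟩
    ext x y
    by_cases h : x.val < n + 1 - k ∧ n + 1 - k ≤ y.val
    · simp only [blockUnip]
      rw [blockUnipMatrix_apply _ h]
      exact congrArg (g.val x) (Fin.ext (by simp only; omega))
    · simp only [blockUnip]
      rw [blockUnipMatrix_apply_of_not _ h]
      rcases lt_trichotomy x y with hxy | rfl | hxy
      · rw [if_neg hxy.ne]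
        have hxy' : x.val < y.val := hxy
        rcases lt_or_ge x.val (n + 1 - k) with hx | hx
        · have e := (weyl_conj_apply_block hk g).1 x.val y.val hx (by omega)
          rw [hl.1 _ _ (Fin.mk_lt_mk.mpr (by omega))] at e
          exact e.symm
        · have e := (weyl_conj_apply_block hk g).2 (x.val - (n + 1 - k)) (y.val - (n + 1 - k))
            (by omega) (by omega)
          rw [hl.1 _ _ (Fin.mk_lt_mk.mpr (by omega))] at e
          have ex : (⟨n + 1 - k + (x.val - (n + 1 - k)), by omega⟩ : Fin (n + 1)) = x :=
            Fin.ext (by simp only; omega)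
          have ey : (⟨n + 1 - k + (y.val - (n + 1 - k)), by omega⟩ : Fin (n + 1)) = y :=
            Fin.ext (by simp only; omega)
          rw [ex, ey] at e
          exact e.symm
      · rw [if_pos rfl, hg1]
      · rw [if_neg hxy.ne', hg x y hxy]
  · rintro ⟨X, rfl⟩
    refine ⟨mem_upperUnip_iff.mpr (isTri_blockUnip hk X), (hlow _).mpr ?_⟩
    -- The columns of w y(X) w⁻¹: up to sign, X moves to the lower left block.
    have h1 : ∀ x, ((weyl K n k * blockUnip hk X * (weyl K n k)⁻¹).val *ᵥ stdVec (n + 1) K x) =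
        if h : x < k then stdVec (n + 1) K x + (-1 : K) ^ (n + 1 - k) •
          ∑ j, X ⟨x, h⟩ j • stdVec (n + 1) K (k + j.val) else stdVec (n + 1) K x := by
      intro x
      rcases lt_or_ge x (n + 1) with hxn | hxn
      · split_ifs with h
        · have e := weyl_stdVec (K := K) hk ⟨x, h⟩
          have e' := weyl_conj_mulVec (k := k) (blockUnip hk X)
            (stdVec (n + 1) K (n + 1 - k + x))
          simp only at e
          have e2 := congrArg (fun v => (-1 : K) ^ (n + 1 - k) • v) e'
          have e3 := blockUnipMatrix_stdVec hk X ⟨x, h⟩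
          simp only at e3 e2
          rw [e, Matrix.mulVec_smul, smul_smul, neg_one_pow_mul_self, one_smul] at e2
          rw [e2]
          simp only [blockUnip]
          rw [e3, Matrix.mulVec_add, e, smul_add, smul_smul, neg_one_pow_mul_self, one_smul,
            Matrix.mulVec_sum]
          simp only [Matrix.mulVec_smul, weyl_stdVec_of_lt hk (Fin.isLt _)]
        · obtain ⟨y, rfl⟩ := Nat.exists_eq_add_of_le (not_lt.mp h)
          have hy : y < n + 1 - k := by omega
          rw [← weyl_stdVec_of_lt hk hy, weyl_conj_mulVec]
          simp only [blockUnip]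
          rw [blockUnipMatrix_stdVec_of_lt _ hy]
      · rw [dif_neg (by omega), stdVec_of_le hxn, Matrix.mulVec_zero]
    have h2 : ∀ x : Fin (n + 1), x.val < k →
        ∀ j : Fin (n + 1 - k), stdVec (n + 1) K (k + j.val) x = 0 := fun x hx j => by
      have : x.val ≠ k + j.val := by omega
      simp [stdVec, this]
    refine ⟨fun x y hxy => ?_, fun x => ?_⟩
    · refine (mulVec_stdVec _ y x).symm.trans ?_
      have hne : y.val ≠ x.val := (Fin.lt_def.mp hxy).ne
      rw [h1]
      split_ifs with h
      · simp [Finset.sum_apply, h2 y ((Fin.lt_def.mp hxy).trans h)]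
        simp [stdVec, hne]
      · simp [stdVec, hne]
    · refine (mulVec_stdVec _ x x).symm.trans ?_
      rw [h1]
      split_ifs with h
      · simp [Finset.sum_apply, h2 x h]
        simp [stdVec]
      · simp [stdVec]

end Weyl

/-! ### Integrality in GL_N(ℚ_p). -/

section Integral

theorem norm_le_of_mem_integralGL {N : ℕ} {g : GL (Fin N) ℚ_[p]} (h : g ∈ integralGL p N)
    (x y : Fin N) : ‖g.val x y‖ ≤ 1 := by
  obtain ⟨g, rfl⟩ := h
  exact (g.val x y).norm_le_one

theorem mem_integralGL {N : ℕ} {g : GL (Fin N) ℚ_[p]} (h : ∀ x y, ‖g.val x y‖ ≤ 1)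
    (h' : ∀ x y, ‖(g⁻¹).val x y‖ ≤ 1) : g ∈ integralGL p N := by
  have hinj : Function.Injective fun A : Matrix (Fin N) (Fin N) ℤ_[p] =>
      (algebraMap ℤ_[p] ℚ_[p]).mapMatrix A := fun A B hAB => by
    ext x y
    have := congrFun (congrFun hAB x) y
    exact Subtype.coe_injective this
  set A : Matrix (Fin N) (Fin N) ℤ_[p] := Matrix.of fun x y => ⟨g.val x y, h x y⟩ with hA
  set B : Matrix (Fin N) (Fin N) ℤ_[p] := Matrix.of fun x y => ⟨(g⁻¹).val x y, h' x y⟩ with hB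
  have hA' : (algebraMap ℤ_[p] ℚ_[p]).mapMatrix A = g.val := rfl
  have hB' : (algebraMap ℤ_[p] ℚ_[p]).mapMatrix B = (g⁻¹).val := rfl
  refine ⟨⟨A, B, hinj ?_, hinj ?_⟩, Units.ext hA'⟩
  · simp only [map_mul, map_one]
    rw [hA', hB', ← Units.val_mul, mul_inv_cancel, Units.val_one]
  · simp only [map_mul, map_one]
    rw [hA', hB', ← Units.val_mul, inv_mul_cancel, Units.val_one]

theorem norm_rootMatrix_le (t : Fin n) {A : Matrix (Fin 2) (Fin 2) ℚ_[p]}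
    (h : ∀ x y, ‖A x y‖ ≤ 1) (x y : Fin (n + 1)) : ‖rootMatrix t A x y‖ ≤ 1 := by
  simp only [rootMatrix, Matrix.of_apply]
  split_ifs <;> simp [h]

theorem phi_bSL_mem_integralGL (t : Fin n) (a : ℚ_[p]) :
    phi t (bSL a) ∈ integralGL p (n + 1) := by
  refine mem_integralGL (norm_rootMatrix_le t (norm_bSL_le a)) (norm_rootMatrix_le t ?_)
  intro x y
  rw [Matrix.SpecialLinearGroup.coe_inv, Matrix.adjugate_fin_two]
  have h := norm_bSL_le a
  fin_cases x <;> fin_cases y <;> simp [h]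

theorem partProd_mem_integralGL (hkn : k ≤ n) (a : Family n k ℚ_[p]) (x : ℕ) :
    partProd hkn a x ∈ integralGL p (n + 1) := by
  refine Subgroup.list_prod_mem _ fun g hg => ?_
  obtain ⟨i, _, rfl⟩ := List.mem_map.mp hg
  refine Subgroup.list_prod_mem _ fun g hg => ?_
  obtain ⟨j, _, rfl⟩ := List.mem_map.mp hg
  exact phi_bSL_mem_integralGL _ _

theorem bMap_mem_integralGL (hkn : k ≤ n) (a : Family n k ℚ_[p]) :
    bMap a ∈ integralGL p (n + 1) := by
  rw [← partProd_eq_bMap hkn]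
  exact partProd_mem_integralGL hkn a k

theorem blockUnip_mem_integralGL_iff (hkn : k ≤ n) (X : Family n k ℚ_[p]) :
    blockUnip hkn X ∈ integralGL p (n + 1) ↔ ∀ i j, ‖X i j‖ ≤ 1 := by
  constructor
  · intro h i j
    rw [← blockUnip_apply hkn X]
    exact norm_le_of_mem_integralGL h _ _
  · intro h
    have : ∀ Z : Family n k ℚ_[p], (∀ i j, ‖Z i j‖ ≤ 1) → ∀ x y,
        ‖(blockUnip hkn Z).val x y‖ ≤ 1 := fun Z hZ x y => by
      simp only [blockUnip, blockUnipMatrix, Matrix.of_apply]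
      split_ifs <;> simp [hZ]
    refine mem_integralGL (this X h) ?_
    rw [blockUnip_inv]
    exact this _ fun i j => by simpa using h i j

theorem mem_UwZ_iff (hkn : k ≤ n) {g : GL (Fin (n + 1)) ℚ_[p]} :
    g ∈ UwZ p n k ↔ ∃ X : Family n k ℚ_[p], (∀ i j, ‖X i j‖ ≤ 1) ∧ g = blockUnip hkn X := by
  rw [UwZ, Subgroup.mem_inf, mem_unipW_iff hkn]
  constructor
  · rintro ⟨⟨X, rfl⟩, h⟩
    exact ⟨X, (blockUnip_mem_integralGL_iff hkn X).mp h, rfl⟩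
  · rintro ⟨X, h, rfl⟩
    exact ⟨⟨X, rfl⟩, (blockUnip_mem_integralGL_iff hkn X).mpr h⟩

theorem le_of_isTri_integral {N : ℕ} {T : GL (Fin N) ℚ_[p]} (hT : T ∈ integralGL p N)
    {d : ℕ → ℚ_[p]} (h : IsTri T d) {y : ℕ} (hy : y < N) : ‖d y‖ ≤ 1 := by
  have := (h y hy).apply (y := ⟨y, hy⟩)
  rw [← this]
  have e := mulVec_stdVec T.val ⟨y, hy⟩ ⟨y, hy⟩
  simp only at e
  rw [e]
  exact norm_le_of_mem_integralGL hT _ _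

end Integral

/-! ### Adapted bases, the big cell decomposition and invariance of μ. -/

section Flag

/-- The vectors which `partProd hkn a x` maps to a triangular family, for `a` with
coordinates `X`. -/
def flagVec (X : Family n k ℚ_[p]) (x y : ℕ) : Fin (n + 1) → ℚ_[p] :=
  if h : y < x ∧ y < k then
    stdVec (n + 1) ℚ_[p] (n + 1 - k + y) - ∑ j, X ⟨y, h.2⟩ j • stdVec (n + 1) ℚ_[p] j.val
  else if y < x + (n + 1 - k) then stdVec (n + 1) ℚ_[p] (y - x)
  else stdVec (n + 1) ℚ_[p] y

/-- The exponent of `p` in the leading coefficients of the triangular family in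
`partProd_flagVec`. -/
def leadExp (m : Family n k ℕ) (x y : ℕ) : ℤ :=
  ∑ i : Fin k, ∑ j : Fin (n + 1 - k), if i.val < x then
    ((if y = x + j.val then (m i j : ℤ) else 0) - if y = i.val then (m i j : ℤ) else 0) else 0

/-- The sign in the leading coefficients of the triangular family in `partProd_flagVec`. -/
def leadSgn (p : ℕ) [Fact p.Prime] (n k x y : ℕ) : ℚ_[p] :=
  if y < x then (-1) ^ (n + 1 - k) else 1

theorem leadSgn_ne_zero (n k x y : ℕ) : leadSgn p n k x y ≠ 0 := by
  unfold leadSgn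
  split_ifs
  · exact pow_ne_zero _ (by simp)
  · exact one_ne_zero

theorem flagVec_of_lt (X : Family n k ℚ_[p]) {x : ℕ} (i : Fin k) (hi : i.val < x) :
    flagVec X x i.val = stdVec (n + 1) ℚ_[p] (n + 1 - k + i.val) -
      ∑ j, X i j • stdVec (n + 1) ℚ_[p] j.val := by
  rw [flagVec, dif_pos ⟨hi, i.isLt⟩]

theorem flagVec_add (X : Family n k ℚ_[p]) (x : ℕ) (j : Fin (n + 1 - k)) :
    flagVec X x (x + j.val) = stdVec (n + 1) ℚ_[p] j.val := by
  rw [flagVec, dif_neg (by omega), if_pos (by have := j.isLt; omega), Nat.add_sub_cancel_left]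

theorem flagVec_of_le (X : Family n k ℚ_[p]) {x y : ℕ} (h : x + (n + 1 - k) ≤ y) :
    flagVec X x y = stdVec (n + 1) ℚ_[p] y := by
  rw [flagVec, dif_neg (by omega), if_neg (by omega)]

theorem lt_or_eq_add_or_le (n : ℕ) {x : ℕ} (hx : x ≤ k) (y : ℕ) :
    (∃ i : Fin k, i.val < x ∧ y = i.val) ∨ (∃ j : Fin (n + 1 - k), y = x + j.val) ∨
      x + (n + 1 - k) ≤ y := by
  rcases lt_or_ge y x with h | h
  · exact Or.inl ⟨⟨y, by omega⟩, h, rfl⟩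
  · rcases lt_or_ge y (x + (n + 1 - k)) with h' | h'
    · exact Or.inr (Or.inl ⟨⟨y - x, by omega⟩, by simp only; omega⟩)
    · exact Or.inr (Or.inr h')

theorem leadExp_of_lt (m : Family n k ℕ) {x : ℕ} (i : Fin k) (hi : i.val < x) :
    leadExp m x i.val = -((∑ j, m i j : ℕ) : ℤ) := by
  rw [leadExp, Finset.sum_eq_single i]
  · have : ∀ j : Fin (n + 1 - k), i.val ≠ x + j.val := fun j => by omega
    simp [hi, this]
  · intro l _ hl
    have h1 : ∀ j : Fin (n + 1 - k), i.val ≠ x + j.val := fun j => by omega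
    have h2 : i.val ≠ l.val := fun h => hl (Fin.ext h.symm)
    simp [h1, h2]
  · simp

theorem leadExp_add (m : Family n k ℕ) (x : ℕ) (j : Fin (n + 1 - k)) :
    leadExp m x (x + j.val) = ((∑ l : Fin k, if l.val < x then m l j else 0 : ℕ) : ℤ) := by
  rw [leadExp, Nat.cast_sum]
  refine Finset.sum_congr rfl fun l _ => ?_
  by_cases hl : l.val < x
  · have h1 : x + j.val ≠ l.val := by omega
    rw [Finset.sum_eq_single j]
    · simp [hl, h1]
    · intro j' _ hj'
      have h2 : j.val ≠ j'.val := fun h => hj' (Fin.ext h.symm)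
      simp [hl, h1, h2]
    · simp
  · simp [hl]

theorem leadExp_of_le (m : Family n k ℕ) {x y : ℕ} (h : x + (n + 1 - k) ≤ y) :
    leadExp m x y = 0 := by
  rw [leadExp]
  refine Finset.sum_eq_zero fun i _ => Finset.sum_eq_zero fun j _ => ?_
  have := j.isLt
  by_cases hi : i.val < x
  · have h1 : y ≠ x + j.val := by omega
    have h2 : y ≠ i.val := by omega
    simp [h1, h2]
  · simp [hi]

theorem partProd_flagVec (hkn : k ≤ n) {a X : Family n k ℚ_[p]} (hX : IsCoord hkn a X) {x : ℕ}
    (hx : x ≤ k) (y : ℕ) :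
    Leads ((partProd hkn a x).val *ᵥ flagVec X x y)
      (leadSgn p n k x y * (p : ℚ_[p]) ^ leadExp (fun i j => mu (a i j)) x y) y := by
  rcases lt_or_eq_add_or_le n hx y with ⟨i, hi, rfl⟩ | ⟨j, rfl⟩ | h
  · rw [flagVec_of_lt X i hi, leadSgn, if_pos hi, leadExp_of_lt _ i hi, _root_.zpow_neg,
      zpow_natCast]
    exact partProd_rowVec hkn hX hx i hi
  · rw [flagVec_add, leadSgn, if_neg (by omega), leadExp_add, one_mul, zpow_natCast]
    exact partProd_leads hkn a hx j
  · rw [flagVec_of_le X h, leadSgn, if_neg (by omega), leadExp_of_le _ h, zpow_zero, one_mul,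
      partProd_stdVec_of_le hkn a hx h, Leads, one_smul, sub_self]
    exact zero_mem _

/-- The adapted basis becomes the signed standard basis under w y(X), with the signs of
`partProd_flagVec`. In the comparison with b(a) the signs cancel and only powers of p remain on the
diagonal. -/
theorem weyl_blockUnip_flagVec (hkn : k ≤ n) (X : Family n k ℚ_[p]) {y : ℕ} (hy : y < n + 1) :
    (weyl ℚ_[p] n k * blockUnip hkn X).val *ᵥ flagVec X k y =
      leadSgn p n k k y • stdVec (n + 1) ℚ_[p] y := by
  rw [Units.val_mul, ← Matrix.mulVec_mulVec]
  rcases lt_or_eq_add_or_le n (le_refl k) y with ⟨i, hi, rfl⟩ | ⟨j, rfl⟩ | h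
  · rw [flagVec_of_lt X i hi, leadSgn, if_pos hi, ← weyl_stdVec hkn, Matrix.mulVec_sub,
      Matrix.mulVec_sum]
    simp only [blockUnip, blockUnipMatrix_stdVec hkn, Matrix.mulVec_smul,
      blockUnipMatrix_stdVec_of_lt _ (Fin.isLt _), add_sub_cancel_right]
  · rw [flagVec_add, leadSgn, if_neg (by omega), one_smul, ← weyl_stdVec_of_lt hkn j.isLt]
    simp only [blockUnip, blockUnipMatrix_stdVec_of_lt _ (Fin.isLt _)]
  · omega

/-- The big cell decomposition of `b(a)`. -/
theorem isTri_bMap (hkn : k ≤ n) {a X : Family n k ℚ_[p]} (hX : IsCoord hkn a X) :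
    IsTri (bMap a * (weyl ℚ_[p] n k * blockUnip hkn X)⁻¹)
      (fun y => (p : ℚ_[p]) ^ leadExp (fun i j => mu (a i j)) k y) := by
  have h := isTri_mul_inv (G := weyl ℚ_[p] n k * blockUnip hkn X) (G' := bMap a)
    (f := flagVec X k) (c := leadSgn p n k k) (fun y _ => leadSgn_ne_zero n k k y)
    (fun y hy => by
      rw [weyl_blockUnip_flagVec hkn X hy, Leads, sub_self]; exact zero_mem _)
    (fun y _ => by rw [← partProd_eq_bMap hkn]; exact partProd_flagVec hkn hX le_rfl y)
  intro y hy
  have := h y hy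
  simp only at this
  rwa [mul_div_cancel_left₀ _ (leadSgn_ne_zero n k k y)] at this

/-- The translation is cut off at row x because the adapted basis of the first x rows involves only
those coordinates; the remaining vectors are standard and must stay fixed. -/
theorem blockUnip_flagVec (hkn : k ≤ n) (X X' : Family n k ℚ_[p]) {x : ℕ} (hx : x ≤ k) {y : ℕ}
    (hy : y < n + 1) :
    (blockUnip hkn fun i j => if i.val < x then X i j - X' i j else 0).val *ᵥ flagVec X x y =
      flagVec X' x y := by
  simp only [blockUnip]
  rcases lt_or_eq_add_or_le n hx y with ⟨i, hi, rfl⟩ | ⟨j, rfl⟩ | h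
  · rw [flagVec_of_lt X i hi, flagVec_of_lt X' i hi, Matrix.mulVec_sub, Matrix.mulVec_sum,
      blockUnipMatrix_stdVec hkn]
    simp only [Matrix.mulVec_smul, blockUnipMatrix_stdVec_of_lt _ (Fin.isLt _), hi, if_true,
      sub_smul, Finset.sum_sub_distrib]
    abel
  · rw [flagVec_add, flagVec_add, blockUnipMatrix_stdVec_of_lt _ j.isLt]
  · rw [flagVec_of_le X h, flagVec_of_le X' h]
    rcases lt_or_exists_eq_add hkn hy with h' | ⟨i, rfl⟩
    · exact blockUnipMatrix_stdVec_of_lt _ h'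
    · rw [blockUnipMatrix_stdVec hkn]
      have : ¬ i.val < x := by omega
      simp [this]

theorem zpow_sub_nonneg_of_norm_le {e e' : ℤ}
    (h : ‖(p : ℚ_[p]) ^ e' / (p : ℚ_[p]) ^ e‖ ≤ 1) : e ≤ e' := by
  have hp1 : (1 : ℝ) < p := by exact_mod_cast (Fact.out : p.Prime).one_lt
  rw [← zpow_sub₀ (p_ne_zero p), Padic.norm_p_zpow, ← zpow_zero (p : ℝ),
    zpow_le_zpow_iff_right₀ hp1] at h
  omega

/-- P' y(Z) P⁻¹, for the two partial products P, P' and the truncated difference Z of coordinates,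
is integral. It is triangular with diagonal p^{e'-e}, which forces e ≤ e'. -/
theorem leadExp_le_of_integral (hkn : k ≤ n) {a a' X X' : Family n k ℚ_[p]}
    (h : IsCoord hkn a X) (h' : IsCoord hkn a' X') (hX : ∀ i j, ‖X' i j - X i j‖ ≤ 1) {x : ℕ}
    (hx : x ≤ k) {y : ℕ} (hy : y < n + 1) :
    leadExp (fun i j => mu (a i j)) x y ≤ leadExp (fun i j => mu (a' i j)) x y := by
  set Z : Family n k ℚ_[p] := fun i j => if i.val < x then X i j - X' i j else 0 with hZ
  have hT := isTri_mul_inv (G := partProd hkn a x) (G' := partProd hkn a' x * blockUnip hkn Z)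
    (f := flagVec X x)
    (c := fun y => leadSgn p n k x y * (p : ℚ_[p]) ^ leadExp (fun i j => mu (a i j)) x y)
    (fun y _ => mul_ne_zero (leadSgn_ne_zero n k x y) (zpow_ne_zero _ (p_ne_zero p)))
    (fun y _ => partProd_flagVec hkn h hx y)
    (fun y hy => by
      rw [Units.val_mul, ← Matrix.mulVec_mulVec, blockUnip_flagVec hkn X X' hx hy]
      exact partProd_flagVec hkn h' hx y)
  have hZ' : blockUnip hkn Z ∈ integralGL p (n + 1) := by
    rw [blockUnip_mem_integralGL_iff]
    intro i j
    simp only [hZ]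
    split_ifs
    · rw [norm_sub_rev]; exact hX i j
    · simp
  have hint := mul_mem (mul_mem (partProd_mem_integralGL hkn a' x) hZ')
    (inv_mem (partProd_mem_integralGL hkn a x))
  have := le_of_isTri_integral hint hT hy
  rw [mul_div_mul_left _ _ (leadSgn_ne_zero n k x y)] at this
  exact zpow_sub_nonneg_of_norm_le this

/-- Exchanging the two families gives equality of the exponents for every partial product. The
exponent at position x+j is the sum of μ(a_{l,j}) over l < x, so the cases x = i and x = i+1 isolate
μ(a_{i,j}). -/
theorem IsCoord.mu_eq {hkn : k ≤ n} {a a' X X' : Family n k ℚ_[p]}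
    (h : IsCoord hkn a X) (h' : IsCoord hkn a' X') (hX : ∀ i j, ‖X' i j - X i j‖ ≤ 1)
    (i : Fin k) (j : Fin (n + 1 - k)) : mu (a' i j) = mu (a i j) := by
  have key : ∀ x ≤ k, colExp a x j = colExp a' x j := fun x hx => by
    have hy : x + j.val < n + 1 := by have := j.isLt; omega
    have h1 := leadExp_le_of_integral hkn h h' hX hx hy
    have h2 := leadExp_le_of_integral hkn h' h
      (fun i j => by rw [norm_sub_rev]; exact hX i j) hx hy
    have h3 := le_antisymm h1 h2
    rw [leadExp_add, leadExp_add] at h3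
    exact_mod_cast h3
  have h1 := key i.val i.isLt.le
  have h2 := key (i.val + 1) i.isLt
  rw [colExp_succ _ i.isLt, colExp_succ _ i.isLt] at h2
  simp only [Fin.eta] at h2
  omega

theorem coordSystem_muInvariant (hkn : k ≤ n) : (coordSystem p hkn).MuInvariant := by
  intro a a' X X' h h' hX s
  obtain ⟨i, j, rfl⟩ := exists_pos s
  have h1 := (coordSystem_sol hkn (a := (famEquiv n k _).symm a)
    (X := (famEquiv n k _).symm X)).mp (by simpa using h)
  have h2 := (coordSystem_sol hkn (a := (famEquiv n k _).symm a')
    (X := (famEquiv n k _).symm X')).mp (by simpa using h')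
  exact h1.mu_eq h2 (fun i j => hX (pos i j)) i j

end Flag

/-! ### Diagonal exponents and the condition defining 𝓜_w(r). -/

section Modulus

/-- With 0-based i and j, the pair contributes to r_l for l in the interval [i+1, k+j]. The
difference r_y - r_{y+1} sees only its ends: +m at y = k+j and -m at y = i. -/
theorem leadExp_eq_sub (hkn : k ≤ n) (m : Family n k ℕ) (y : ℕ) :
    leadExp m k y =
      ((∑ i : Fin k, ∑ j : Fin (n + 1 - k),
        if i.val + 1 ≤ y ∧ y ≤ k + j.val then m i j else 0 : ℕ) : ℤ) -
      ((∑ i : Fin k, ∑ j : Fin (n + 1 - k),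
        if i.val + 1 ≤ y + 1 ∧ y + 1 ≤ k + j.val then m i j else 0 : ℕ) : ℤ) := by
  rw [leadExp]
  push_cast
  rw [← Finset.sum_sub_distrib]
  refine Finset.sum_congr rfl fun i _ => ?_
  rw [← Finset.sum_sub_distrib]
  refine Finset.sum_congr rfl fun j _ => ?_
  have := i.isLt
  split_ifs <;> omega

theorem modulusExp_eq_leadExp (hkn : k ≤ n) {m : Family n k ℕ} {r : Fin n → ℕ}
    (hm : m ∈ MSet k r) (y : Fin (n + 1)) : modulusExp r y = leadExp m k y.val := by
  rw [leadExp_eq_sub hkn, modulusExp]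
  congr 1
  · refine Fin.cases ?_ (fun l => ?_) y
    · simp
    · rw [Fin.cons_succ, ← hm l]
      rfl
  · refine Fin.lastCases ?_ (fun l => ?_) y
    · rw [Fin.snoc_last, eq_comm, Nat.cast_inj]
      refine Finset.sum_eq_zero fun i _ => Finset.sum_eq_zero fun j _ => ?_
      have := j.isLt
      rw [if_neg (by simp only [Fin.val_last]; omega)]
    · rw [Fin.snoc_castSucc, ← hm l]
      rfl

theorem modulusExp_injective : Function.Injective (modulusExp : (Fin n → ℕ) → _) := by
  intro r r' h
  suffices ∀ l (hl : l < n), r ⟨l, hl⟩ = r' ⟨l, hl⟩ from funext fun l => this l.val l.isLt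
  intro l
  induction l with
  | zero =>
    intro hl
    have h1 := congrFun h (⟨0, hl⟩ : Fin n).castSucc
    rw [modulusExp, modulusExp, Fin.snoc_castSucc, Fin.snoc_castSucc] at h1
    have h2 : (⟨0, hl⟩ : Fin n).castSucc = 0 := rfl
    rw [h2, Fin.cons_zero, Fin.cons_zero] at h1
    omega
  | succ l ih =>
    intro hl
    have h1 := congrFun h (⟨l + 1, hl⟩ : Fin n).castSucc
    rw [modulusExp, modulusExp, Fin.snoc_castSucc, Fin.snoc_castSucc] at h1
    have h2 : (⟨l + 1, hl⟩ : Fin n).castSucc = (⟨l, by omega⟩ : Fin n).succ := rfl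
    rw [h2, Fin.cons_succ, Fin.cons_succ, ih (by omega)] at h1
    omega

theorem mem_MSet_of_modulusExp_eq (hkn : k ≤ n) {m : Family n k ℕ} {r : Fin n → ℕ}
    (h : ∀ y : Fin (n + 1), modulusExp r y = leadExp m k y.val) : m ∈ MSet k r := by
  set r' : Fin n → ℕ := fun l => ∑ i : Fin k, ∑ j : Fin (n + 1 - k),
    if i.val + 1 ≤ l.val + 1 ∧ l.val + 1 ≤ k + j.val then m i j else 0 with hr'
  have hm : m ∈ MSet k r' := fun _ => rfl
  have : r = r' := modulusExp_injective
    (funext fun y => (h y).trans (modulusExp_eq_leadExp hkn hm y).symm)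
  rwa [this]

end Modulus

/-! ### Comparison of b(a) with the Bruhat cell of 𝔫. -/

section Cell

theorem IsTri.congr {N : ℕ} {K : Type*} [Field K] {g : GL (Fin N) K} {d e : ℕ → K}
    (h : IsTri g d) (hde : ∀ y < N, d y = e y) : IsTri g e := fun y hy => hde y hy ▸ h y hy

/-- The diagonal entries of the modulus. -/
def modulusDiag (p : ℕ) [Fact p.Prime] (r : Fin n → ℕ) (y : ℕ) : ℚ_[p] :=
  if h : y < n + 1 then (p : ℚ_[p]) ^ modulusExp r ⟨y, h⟩ else 1

theorem modulusDiag_ne_zero (r : Fin n → ℕ) (y : ℕ) : modulusDiag p r y ≠ 0 := by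
  unfold modulusDiag
  split_ifs
  · exact zpow_ne_zero _ (p_ne_zero p)
  · exact one_ne_zero

theorem isTri_modulus (r : Fin n → ℕ) : IsTri (modulus p r) (modulusDiag p r) := by
  intro y hy x hx
  have e := mulVec_stdVec (modulus p r).val x ⟨y, hy⟩
  simp only at e
  rw [Pi.sub_apply, e, modulusDiag, dif_pos hy]
  rcases hx.eq_or_lt with rfl | hlt
  · simp [modulus, stdVec]
  · have h1 : x ≠ ⟨y, hy⟩ := fun h => hlt.ne' (Fin.ext_iff.mp h)
    simp [modulus, stdVec, hlt.ne', h1]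

/-- For g with diagonal blocks A, D and upper right block B, take X = A⁻¹B: removing y(X) leaves
diag(A, D), whose conjugate by w is again upper unipotent. -/
theorem exists_block_decomposition {K : Type*} [Field K] (hkn : k ≤ n) {g : GL (Fin (n + 1)) K}
    (hg : g ∈ upperUnip (n + 1) K) : ∃ X : Family n k K,
      weyl K n k * (g * (blockUnip hkn X)⁻¹) * (weyl K n k)⁻¹ ∈ upperUnip (n + 1) K := by
  have hinv := mem_upperUnip_iff.mp ((upperUnip (n + 1) K).inv_mem hg)
  -- The columns of B padded by zeros; on such vectors g⁻¹ acts as A⁻¹.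
  set top : Fin k → Fin (n + 1) → K := fun i x =>
    if x.val < n + 1 - k then (g.val *ᵥ stdVec (n + 1) K (n + 1 - k + i.val)) x else 0 with htop
  have htop_mem : ∀ i, (g⁻¹).val *ᵥ top i ∈ flag (n + 1) K (n + 1 - k) := fun i =>
    hinv.mem_flag fun x hx => by simp only [htop]; rw [if_neg (by omega)]
  set X : Family n k K := fun i j =>
    ((g⁻¹).val *ᵥ top i) ⟨j.val, by have := j.isLt; omega⟩ with hX
  have hsum : ∀ i, ∑ j, X i j • stdVec (n + 1) K j.val = (g⁻¹).val *ᵥ top i := fun i => by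
    ext x
    rw [Finset.sum_apply]
    by_cases hx : x.val < n + 1 - k
    · rw [Finset.sum_eq_single ⟨x.val, hx⟩]
      · simp [hX, stdVec]
      · intro j _ hj
        have : x.val ≠ j.val := fun h => hj (Fin.ext h.symm)
        simp [stdVec, this]
      · simp
    · rw [htop_mem i x (by omega), Finset.sum_eq_zero]
      intro j _
      have : x.val ≠ j.val := by have := j.isLt; omega
      simp [stdVec, this]
  have htri := (mem_upperUnip_iff.mp hg).mul
    (isTri_blockUnip hkn (-X))
  refine ⟨X, mem_upperUnip_iff.mpr fun y hy => ?_⟩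
  rw [blockUnip_inv]
  rcases lt_or_ge y k with hyk | hyk
  · have h1 := htri (n + 1 - k + y) (by omega)
    have h2 : ∀ x : Fin (n + 1), x.val < n + 1 - k →
        ((g * blockUnip hkn (-X)).val *ᵥ stdVec (n + 1) K (n + 1 - k + y)) x = 0 := by
      intro x hx
      have e := blockUnipMatrix_stdVec hkn (-X) ⟨y, hyk⟩
      simp only at e
      rw [Units.val_mul, ← Matrix.mulVec_mulVec]
      simp only [blockUnip]
      rw [e]
      simp only [Pi.neg_apply, neg_smul, Finset.sum_neg_distrib]
      rw [hsum, Matrix.mulVec_add, Matrix.mulVec_neg, Matrix.mulVec_mulVec, ← Units.val_mul,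
        mul_inv_cancel, Units.val_one, Matrix.one_mulVec]
      simp [htop, hx]
    intro x hx
    have e := weyl_conj_apply_of_lt hkn (g * blockUnip hkn (-X)) x ⟨y, hyk⟩
    have e' := mulVec_stdVec (weyl K n k * (g * blockUnip hkn (-X)) * (weyl K n k)⁻¹).val x
      ⟨y, hy⟩
    simp only at e e'
    rw [Pi.sub_apply, e', e]
    rcases lt_or_ge x.val k with hxk | hxk
    · rw [weyl_mulVec_of_lt hkn _ hxk, ← mul_assoc, neg_one_pow_mul_self, one_mul]
      have := h1 ⟨n + 1 - k + x.val, by omega⟩ (by simp only; omega)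
      simpa [stdVec] using this
    · have hne : x.val ≠ y := by omega
      rw [weyl_mulVec_of_le _ hxk, h2 _ (by simp only; omega)]
      simp [stdVec, hne]
  · obtain ⟨z, rfl⟩ := Nat.exists_eq_add_of_le hyk
    have hz : z < n + 1 - k := by omega
    have h1 := htri z (by omega)
    rw [← weyl_stdVec_of_lt hkn hz, weyl_conj_mulVec, Leads, one_smul,
      ← weyl_stdVec_of_lt hkn hz, ← Matrix.mulVec_sub]
    refine mulVec_mem_of_flag (fun t ht _ => ?_) (by simpa [Leads] using h1)
    rw [weyl_stdVec_of_lt hkn (by omega)]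
    exact stdVec_mem_flag (by omega)

/-- Comparing the two big cell decompositions shows that w y(X' - X - Z) w⁻¹ is upper triangular.
Its lower left block is ±(X' - X - Z) up to transposition, so this difference vanishes. -/
theorem coord_eq_of_bMap_eq (hkn : k ≤ n) {a a' X X' Z : Family n k ℚ_[p]}
    (h : IsCoord hkn a X) (h' : IsCoord hkn a' X') {u : GL (Fin (n + 1)) ℚ_[p]}
    (hu : u ∈ upperUnip (n + 1) ℚ_[p]) (e : bMap a' = u * bMap a * blockUnip hkn Z) :
    X' = X + Z := by
  set w := weyl ℚ_[p] n k with hw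
  have hT := ((isTri_bMap hkn h').inv fun y _ => zpow_ne_zero _ (p_ne_zero p)).mul
    ((mem_upperUnip_iff.mp hu).mul (isTri_bMap hkn h))
  have key : (bMap a' * (w * blockUnip hkn X')⁻¹)⁻¹ * (u * (bMap a * (w * blockUnip hkn X)⁻¹)) =
      w * blockUnip hkn (X' - (X + Z)) * w⁻¹ := by
    have e1 : blockUnip hkn (X' - (X + Z)) =
        blockUnip hkn X' * (blockUnip hkn Z)⁻¹ * (blockUnip hkn X)⁻¹ := by
      rw [blockUnip_inv, blockUnip_inv, blockUnip_mul, blockUnip_mul]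
      congr 1
      abel
    rw [e1, e]
    group
  rw [← hw, key] at hT
  ext i j
  have hi := i.isLt
  have hj := j.isLt
  have h1 := (hT i.val (by omega)).mem_flag (Nat.lt_succ_self _) ⟨k + j.val, by omega⟩
    (by simp only; omega)
  have h2 := mulVec_stdVec (w * blockUnip hkn (X' - (X + Z)) * w⁻¹).val
    ⟨k + j.val, by omega⟩ ⟨i.val, by omega⟩
  simp only at h2
  rw [h1, hw, weyl_conj_apply_of_lt hkn, weyl_mulVec_of_le _ (by simp)] at h2
  simp only [add_tsub_cancel_left] at h2
  have h3 := mulVec_stdVec (blockUnip hkn (X' - (X + Z))).val ⟨j.val, by omega⟩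
    ⟨n + 1 - k + i.val, by omega⟩
  simp only at h3
  rw [h3, blockUnip_apply] at h2
  have h4 := (mul_eq_zero.mp h2.symm).resolve_left (pow_ne_zero _ (by simp))
  exact sub_eq_zero.mp h4

/-- When X' = X + Z the factor w y(X') cancels and leaves a quotient of two triangular matrices.
Equal μ give equal diagonals, so the quotient is unipotent; integrality is clear from the factors.
-/
theorem bMap_mul_inv_mem_UZ (hkn : k ≤ n) {a a' X X' Z : Family n k ℚ_[p]}
    (h : IsCoord hkn a X) (h' : IsCoord hkn a' X') (hmu : ∀ i j, mu (a' i j) = mu (a i j))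
    (hZ : ∀ i j, ‖Z i j‖ ≤ 1) (hX : X' = X + Z) :
    bMap a' * (bMap a * blockUnip hkn Z)⁻¹ ∈ UZ p n := by
  have hint : bMap a' * (bMap a * blockUnip hkn Z)⁻¹ ∈ integralGL p (n + 1) :=
    mul_mem (bMap_mem_integralGL hkn a') (inv_mem (mul_mem (bMap_mem_integralGL hkn a)
      ((blockUnip_mem_integralGL_iff hkn Z).mpr hZ)))
  refine ⟨?_, hint⟩
  have hT := (isTri_bMap hkn h').mul
    ((isTri_bMap hkn h).inv fun y _ => zpow_ne_zero _ (p_ne_zero p))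
  have key : bMap a' * (weyl ℚ_[p] n k * blockUnip hkn X')⁻¹ *
      (bMap a * (weyl ℚ_[p] n k * blockUnip hkn X)⁻¹)⁻¹ =
      bMap a' * (bMap a * blockUnip hkn Z)⁻¹ := by
    rw [hX, ← blockUnip_mul]
    group
  rw [key] at hT
  refine mem_upperUnip_iff.mpr (hT.congr fun y _ => ?_)
  simp only [hmu]
  exact mul_inv_cancel₀ (zpow_ne_zero _ (p_ne_zero p))

theorem bMap_mem_kloosC (hkn : k ≤ n) {r : Fin n → ℕ} {m : Family n k ℕ} (hm : m ∈ MSet k r)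
    {a : Family n k ℚ_[p]} (ha : a ∈ Y p m) : bMap a ∈ kloosC p k r := by
  refine ⟨?_, bMap_mem_integralGL hkn a⟩
  obtain ⟨X, hX⟩ := exists_isCoord_right hkn a
  have hT := (isTri_bMap hkn hX).mul
    ((isTri_modulus r).inv fun y _ => modulusDiag_ne_zero (p := p) r y)
  refine ⟨_, mem_upperUnip_iff.mpr (hT.congr fun y hy => ?_), blockUnip hkn X,
    mem_upperUnip_iff.mpr (isTri_blockUnip hkn X), ?_⟩
  · have hm' : (fun i j => mu (a i j)) = m := by ext i j; exact ha i j
    rw [hm', modulusDiag, dif_pos hy, modulusExp_eq_leadExp hkn hm]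
    exact mul_inv_cancel₀ (zpow_ne_zero _ (p_ne_zero p))
  · group

theorem exists_bMap_mem_UZ_mul (hkn : k ≤ n) {r : Fin n → ℕ} {g : GL (Fin (n + 1)) ℚ_[p]}
    (hg : g ∈ kloosC p k r) : ∃ m ∈ MSet k r, ∃ a ∈ Y p m, g * (bMap a)⁻¹ ∈ UZ p n := by
  obtain ⟨⟨x, hx, y, hy, rfl⟩, hint⟩ := hg
  obtain ⟨X, hX⟩ := exists_block_decomposition hkn hy
  obtain ⟨a, ha⟩ := exists_isCoord_left hkn X
  set w := weyl ℚ_[p] n k with hw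
  set g := x * (modulus p r * w) * y with hg
  have h1 := ((mem_upperUnip_iff.mp hx).mul (isTri_modulus r)).mul (mem_upperUnip_iff.mp hX)
  have h2 := isTri_bMap hkn ha
  rw [← hw] at h2
  have key : x * modulus p r * (w * (y * (blockUnip hkn X)⁻¹) * w⁻¹) =
      g * (w * blockUnip hkn X)⁻¹ := by
    rw [hg]; group
  rw [key] at h1
  have h3 := h1.mul (h2.inv fun y _ => zpow_ne_zero _ (p_ne_zero p))
  -- The quotient and its inverse are both needed: integrality of each gives one inequality between
  -- the exponents.
  have h4 := h2.mul (h1.inv fun y _ => by simpa using modulusDiag_ne_zero r y)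
  have key3 : g * (w * blockUnip hkn X)⁻¹ * (bMap a * (w * blockUnip hkn X)⁻¹)⁻¹ =
      g * (bMap a)⁻¹ := by group
  have key4 : bMap a * (w * blockUnip hkn X)⁻¹ * (g * (w * blockUnip hkn X)⁻¹)⁻¹ =
      bMap a * g⁻¹ := by group
  rw [key3] at h3
  rw [key4] at h4
  have hb := bMap_mem_integralGL hkn a
  have hexp : ∀ y : Fin (n + 1), modulusExp r y = leadExp (fun i j => mu (a i j)) k y.val := by
    intro y
    have e3 := le_of_isTri_integral (mul_mem hint (inv_mem hb)) h3 y.isLt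
    have e4 := le_of_isTri_integral (mul_mem hb (inv_mem hint)) h4 y.isLt
    simp only [modulusDiag, y.isLt, dite_true, one_mul, mul_one, ← div_eq_mul_inv] at e3 e4
    exact le_antisymm (zpow_sub_nonneg_of_norm_le e4) (zpow_sub_nonneg_of_norm_le e3)
  have hgb : g * (bMap a)⁻¹ ∈ integralGL p (n + 1) := mul_mem hint (inv_mem hb)
  refine ⟨fun i j => mu (a i j), mem_MSet_of_modulusExp_eq hkn hexp, a, fun _ _ => rfl,
    mem_upperUnip_iff.mpr (h3.congr fun y hy => ?_), hgb⟩
  simp only [modulusDiag, hy, dite_true, one_mul, mul_one, hexp]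
  exact mul_inv_cancel₀ (zpow_ne_zero _ (p_ne_zero p))

end Cell

/-! ### Orbit representatives in C_w(m). -/

section Representatives

theorem gcd_eq_one_of_mu {m : ℕ} {c : ℤ}
    (h : mu ((c : ℚ_[p]) * (p : ℚ_[p]) ^ (-(m : ℤ))) = m) : Int.gcd c ((p : ℤ) ^ m) = 1 := by
  rcases Nat.eq_zero_or_pos m with rfl | hm
  · simp
  · have hgt : ¬ ‖(c : ℚ_[p]) * (p : ℚ_[p]) ^ (-(m : ℤ))‖ ≤ 1 := fun hle => by
      rw [mu, if_pos hle] at h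
      omega
    have h1 := norm_mul_pow_mu hgt
    rw [h, _root_.zpow_neg, zpow_natCast,
      inv_mul_cancel_right₀ (pow_ne_zero _ (p_ne_zero p))] at h1
    have h2 : ¬ (p : ℤ) ∣ c := fun hd => by
      have := (Padic.norm_intCast_lt_one_iff (p := p)).mpr hd
      linarith
    rw [← Int.isCoprime_iff_gcd_eq_one]
    exact (((Nat.prime_iff_prime_int.mp (Fact.out : p.Prime)).coprime_iff_not_dvd.mpr
      h2).symm).pow_right

theorem exists_param (hkn : k ≤ n) {m : Family n k ℕ} {a X : Family n k ℚ_[p]}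
    (h : IsCoord hkn a X) (ha : a ∈ Y p m) : ∃ c ∈ CSet p m, ∃ X',
      IsCoord hkn (param p m c) X' ∧ ∀ i j, ‖X' i j - X i j‖ ≤ 1 := by
  obtain ⟨b, Z, c, h1, h2, h3⟩ := TriangularSystem.exists_representative
    (coordSystem_muInvariant hkn) ((coordSystem_sol hkn).mpr h)
  have h1' : IsCoord hkn ((famEquiv n k _).symm b) ((famEquiv n k _).symm Z) :=
    (coordSystem_sol hkn).mp (by simpa using h1)
  have hmu : ∀ i j, mu (b (pos i j)) = m i j := fun i j =>
    (h.mu_eq h1' (fun i j => h2 (pos i j)) i j).trans (ha i j)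
  have hb : (famEquiv n k _).symm b = param p m ((famEquiv n k _).symm c) := by
    ext i j
    have := (h3 (pos i j)).2.2
    rw [hmu i j] at this
    exact this
  refine ⟨(famEquiv n k _).symm c, fun i j => ?_, (famEquiv n k _).symm Z, hb ▸ h1',
    fun i j => h2 (pos i j)⟩
  obtain ⟨e1, e2, e3⟩ := h3 (pos i j)
  have hE : (coordSystem p hkn).exponent (pos i j) b + mu (b (pos i j)) = bigM m i j := by
    have := coordSystem_exponent (p := p) hkn ((famEquiv n k _).symm b) i j
    rw [Equiv.apply_symm_apply] at this
    rw [this, bigM, hmu]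
    exact congrArg (· + _) (congrArg₂ _ (Finset.sum_congr rfl fun l _ => hmu l j)
      (Finset.sum_congr rfl fun l _ => hmu i l))
  rw [hE] at e2
  rw [hmu] at e3
  refine ⟨e1, e2, gcd_eq_one_of_mu (p := p) ?_⟩
  change mu ((c (pos i j) : ℚ_[p]) * _) = _
  rw [← e3, hmu]

theorem param_mem_Y {m : Family n k ℕ} {c : Family n k ℤ} (hc : c ∈ CSet p m) :
    param p m c ∈ Y p m := (paramY p m ⟨c, hc⟩).property

theorem param_unique (hkn : k ≤ n) {m : Family n k ℕ} {c c' : Family n k ℤ} (hc : c ∈ CSet p m)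
    (hc' : c' ∈ CSet p m) {X X' : Family n k ℚ_[p]} (h : IsCoord hkn (param p m c) X)
    (h' : IsCoord hkn (param p m c') X') (hX : ∀ i j, ‖X' i j - X i j‖ ≤ 1) : c = c' := by
  have key : ∀ c ∈ CSet p m, ∀ s : Pos n k, 0 ≤ famEquiv n k ℤ c s ∧
      famEquiv n k ℤ c s < (p : ℤ) ^ ((coordSystem p hkn).exponent s
        (famEquiv n k _ (param p m c)) + famEquiv n k ℕ m s) ∧
      famEquiv n k _ (param p m c) s =
        (famEquiv n k ℤ c s : ℚ_[p]) * (p : ℚ_[p]) ^ (-(famEquiv n k ℕ m s : ℤ)) := by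
    intro c hc s
    obtain ⟨i, j, rfl⟩ := exists_pos s
    have hY := param_mem_Y hc
    refine ⟨(hc i j).1, ?_, rfl⟩
    rw [coordSystem_exponent]
    simp only [famEquiv_pos, hY _ _]
    exact (hc i j).2.1
  refine (famEquiv n k _).injective (funext fun s => ?_)
  exact TriangularSystem.representative_unique ((coordSystem_sol hkn).mpr h)
    ((coordSystem_sol hkn).mpr h') (fun s => hX _ _) (key c hc) (key c' hc') s

end Representatives

/-! ### The action of U_w(ℤ_p) by translation, and equality of classes. -/

section Action

/-- The coordinates of a family. -/
def coord (hkn : k ≤ n) (a : Family n k ℚ_[p]) : Family n k ℚ_[p] :=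
  (exists_isCoord_right hkn a).choose

theorem isCoord_coord (hkn : k ≤ n) (a : Family n k ℚ_[p]) : IsCoord hkn a (coord hkn a) :=
  (exists_isCoord_right hkn a).choose_spec

/-- The family with given coordinates. -/
def ofCoord (hkn : k ≤ n) (X : Family n k ℚ_[p]) : Family n k ℚ_[p] :=
  (exists_isCoord_left hkn X).choose

theorem isCoord_ofCoord (hkn : k ≤ n) (X : Family n k ℚ_[p]) : IsCoord hkn (ofCoord hkn X) X :=
  (exists_isCoord_left hkn X).choose_spec

theorem coord_ofCoord (hkn : k ≤ n) (X : Family n k ℚ_[p]) : coord hkn (ofCoord hkn X) = X :=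
  (isCoord_coord hkn _).eq_right (isCoord_ofCoord hkn X)

theorem ofCoord_coord (hkn : k ≤ n) (a : Family n k ℚ_[p]) : ofCoord hkn (coord hkn a) = a :=
  (isCoord_ofCoord hkn _).eq_left (isCoord_coord hkn a)

theorem ofCoord_mem_Y (hkn : k ≤ n) {m : Family n k ℕ} {a Z : Family n k ℚ_[p]} (ha : a ∈ Y p m)
    (hZ : ∀ i j, ‖Z i j‖ ≤ 1) : ofCoord hkn (coord hkn a + Z) ∈ Y p m := fun i j =>
  ((isCoord_coord hkn a).mu_eq (isCoord_ofCoord hkn _) (fun i j => by simpa using hZ i j)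
    i j).trans (ha i j)

/-- The upper right block of an element of `U_w(ℤ_p)`. -/
def unipCoord (hkn : k ≤ n) (u : UwZ p n k) : Family n k ℚ_[p] :=
  ((mem_UwZ_iff hkn).mp u.property).choose

theorem norm_unipCoord_le (hkn : k ≤ n) (u : UwZ p n k) (i : Fin k) (j : Fin (n + 1 - k)) :
    ‖unipCoord hkn u i j‖ ≤ 1 :=
  ((mem_UwZ_iff hkn).mp u.property).choose_spec.1 i j

theorem blockUnip_unipCoord (hkn : k ≤ n) (u : UwZ p n k) :
    blockUnip hkn (unipCoord hkn u) = u :=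
  ((mem_UwZ_iff hkn).mp u.property).choose_spec.2.symm

theorem unipCoord_one (hkn : k ≤ n) : unipCoord hkn (1 : UwZ p n k) = 0 :=
  blockUnip_injective hkn (by rw [blockUnip_unipCoord, blockUnip_zero]; rfl)

theorem unipCoord_mul (hkn : k ≤ n) (u v : UwZ p n k) :
    unipCoord hkn (u * v) = unipCoord hkn u + unipCoord hkn v :=
  blockUnip_injective hkn (by
    rw [← blockUnip_mul, blockUnip_unipCoord, blockUnip_unipCoord, blockUnip_unipCoord]; rfl)

/-- The right action of `U_w(ℤ_p)` on `Y(m)`, which is translation of the coordinates. -/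
@[reducible]
def unipAction (hkn : k ≤ n) (m : Family n k ℕ) : MulAction (UwZ p n k)ᵐᵒᵖ (Y p m) where
  smul u a := ⟨ofCoord hkn (coord hkn a.val + unipCoord hkn u.unop),
    ofCoord_mem_Y hkn a.property (norm_unipCoord_le hkn u.unop)⟩
  one_smul a := Subtype.ext (by
    change ofCoord hkn (coord hkn a.val + unipCoord hkn 1) = a.val
    rw [unipCoord_one, add_zero, ofCoord_coord])
  mul_smul u v a := Subtype.ext (by
    change ofCoord hkn (coord hkn a.val + unipCoord hkn (v.unop * u.unop)) =
      ofCoord hkn (coord hkn (ofCoord hkn (coord hkn a.val + unipCoord hkn v.unop)) +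
        unipCoord hkn u.unop)
    rw [coord_ofCoord, unipCoord_mul, add_assoc])

theorem coord_unipAction (hkn : k ≤ n) (m : Family n k ℕ) (u : (UwZ p n k)ᵐᵒᵖ) (a : Y p m) :
    coord hkn ((unipAction hkn m).smul u a).val = coord hkn a.val + unipCoord hkn u.unop :=
  coord_ofCoord hkn _

theorem orbitRel_unipAction (hkn : k ≤ n) (m : Family n k ℕ) (a b : Y p m) :
    (@MulAction.orbitRel (UwZ p n k)ᵐᵒᵖ (Y p m) _ (unipAction hkn m)) a b ↔
      ∀ i j, ‖coord hkn a.val i j - coord hkn b.val i j‖ ≤ 1 := by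
  constructor
  · rintro ⟨u, hu⟩ i j
    have hu' : (unipAction hkn m).smul u b = a := hu
    rw [← hu', coord_unipAction]
    simpa using norm_unipCoord_le hkn u.unop i j
  · intro h
    set u : UwZ p n k := ⟨blockUnip hkn (coord hkn a.val - coord hkn b.val),
      (mem_UwZ_iff hkn).mpr ⟨_, h, rfl⟩⟩ with hu
    have e : unipCoord hkn u = coord hkn a.val - coord hkn b.val :=
      blockUnip_injective hkn (by rw [blockUnip_unipCoord])
    refine ⟨MulOpposite.op u, Subtype.ext ?_⟩
    change ofCoord hkn (coord hkn b.val + unipCoord hkn u) = a.val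
    rw [e, add_sub_cancel, ofCoord_coord]

theorem leftClass_eq_iff {g g' : GL (Fin (n + 1)) ℚ_[p]} :
    leftClass p g = leftClass p g' ↔ g' * g⁻¹ ∈ UZ p n := by
  rw [leftClass, leftClass, Quotient.eq, QuotientGroup.rightRel_apply]

theorem doubleClass_eq_iff {g g' : GL (Fin (n + 1)) ℚ_[p]} :
    doubleClass p k g = doubleClass p k g' ↔
      ∃ u ∈ UZ p n, ∃ v ∈ UwZ p n k, g' = u * g * v := by
  refine Iff.trans (Quotient.eq (r := DoubleCoset.setoid _ _)) ?_
  exact DoubleCoset.rel_iff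

end Action

end

end Kloos

/-! ### Assembly of the two statements. -/

theorem theorem3p2 (p : ℕ) [Fact p.Prime] (n k : ℕ) (hk : 1 ≤ k) (hkn : k ≤ n) (r : Fin n → ℕ) :
    (∀ m ∈ Kloos.MSet k r,
      -- `b` is injective from `Y(m)` to `U(ℤ_p) \ C(𝔫)`
      (∀ a ∈ Kloos.Y p m, Kloos.bMap a ∈ Kloos.kloosC p k r) ∧
      Set.InjOn (fun a => Kloos.leftClass p (Kloos.bMap a)) (Kloos.Y p m) ∧
      -- the right action of `U_w(ℤ_p)` on `Y(m)` for which `b` is equivariant, and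
      -- `C_w(m)` as a system of representatives of its orbits
      ∃ act : MulAction (Kloos.UwZ p n k)ᵐᵒᵖ (Kloos.Y p m),
        (∀ (u : Kloos.UwZ p n k) (a : Kloos.Y p m),
          Kloos.leftClass p (Kloos.bMap (act.smul (MulOpposite.op u) a).val) =
            Kloos.leftClass p (Kloos.bMap a.val * (u : GL (Fin (n + 1)) ℚ_[p]))) ∧
        Function.Bijective fun c : Kloos.CSet p m =>
          (Quotient.mk (@MulAction.orbitRel (Kloos.UwZ p n k)ᵐᵒᵖ (Kloos.Y p m) _ act)
            (Kloos.paramY p m c))) ∧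
    -- the disjoint union of the `C_w(m)`, `m ∈ 𝓜_w(r)`, as a full system of representatives
    Set.BijOn
      (fun q : Kloos.Family n k ℕ × Kloos.Family n k ℤ =>
        Kloos.doubleClass p k (Kloos.bMap (Kloos.param p q.1 q.2)))
      {q | q.1 ∈ Kloos.MSet k r ∧ q.2 ∈ Kloos.CSet p q.1}
      (Kloos.kloosX p k r) := by
  refine ⟨fun m hm => ⟨fun a ha => Kloos.bMap_mem_kloosC hkn hm ha, ?_,
    Kloos.unipAction hkn m, ?_, ?_, ?_⟩, ?_, ?_, ?_⟩
  · intro a _ a' _ h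
    have h1 := (Kloos.isCoord_coord hkn a')
    -- Equality of left cosets is the case of trivial translation.
    have h2 := Kloos.coord_eq_of_bMap_eq hkn (Z := 0) (Kloos.isCoord_coord hkn a) h1
      (Kloos.leftClass_eq_iff.mp h).1
      (by rw [Kloos.blockUnip_zero, mul_one, inv_mul_cancel_right])
    rw [h2, add_zero] at h1
    exact (Kloos.isCoord_coord hkn a).eq_left h1
  · intro u a
    rw [eq_comm, Kloos.leftClass_eq_iff, ← Kloos.blockUnip_unipCoord hkn u]
    refine Kloos.bMap_mul_inv_mem_UZ hkn (Kloos.isCoord_coord hkn a.val)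
      (Kloos.isCoord_coord hkn _) (fun i j => ?_) (Kloos.norm_unipCoord_le hkn u)
      (Kloos.coord_unipAction hkn m (MulOpposite.op u) a)
    exact (((Kloos.unipAction hkn m).smul (MulOpposite.op u) a).property i j).trans
      (a.property i j).symm
  · intro c c' h
    have h1 := (Kloos.orbitRel_unipAction hkn m _ _).mp (Quotient.exact h.symm)
    exact Subtype.ext (Kloos.param_unique hkn c.property c'.property
      (Kloos.isCoord_coord hkn _) (Kloos.isCoord_coord hkn _) h1)
  · intro q
    induction q using Quotient.ind with
    | _ a =>
      obtain ⟨c, hc, X', hX', hint⟩ :=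
        Kloos.exists_param hkn (Kloos.isCoord_coord hkn a.val) a.property
      refine ⟨⟨c, hc⟩, Quotient.sound ((Kloos.orbitRel_unipAction hkn m _ _).mpr ?_)⟩
      have : Kloos.coord hkn (Kloos.paramY p m ⟨c, hc⟩).val = X' :=
        (Kloos.isCoord_coord hkn _).eq_right hX'
      rw [this]
      exact hint
  · rintro ⟨m, c⟩ ⟨hm, hc⟩
    exact ⟨_, Kloos.bMap_mem_kloosC hkn hm (Kloos.param_mem_Y hc), rfl⟩
  · rintro ⟨m, c⟩ ⟨hm, hc⟩ ⟨m', c'⟩ ⟨hm', hc'⟩ h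
    simp only at hm hc hm' hc' h
    obtain ⟨u, hu, v, hv, e⟩ := Kloos.doubleClass_eq_iff.mp h
    obtain ⟨Z, hZ, rfl⟩ := (Kloos.mem_UwZ_iff hkn).mp hv
    have h1 := Kloos.coord_eq_of_bMap_eq hkn (Kloos.isCoord_coord hkn _)
      (Kloos.isCoord_coord hkn _) hu.1 e
    have h2 : ∀ i j, ‖Kloos.coord hkn (Kloos.param p m' c') i j -
        Kloos.coord hkn (Kloos.param p m c) i j‖ ≤ 1 := fun i j => by
      rw [h1]; simpa using hZ i j
    -- The double coset determines m because μ is invariant under integral translation.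
    obtain rfl : m' = m := by
      ext i j
      rw [← Kloos.param_mem_Y hc i j, ← Kloos.param_mem_Y hc' i j]
      exact (Kloos.isCoord_coord hkn _).mu_eq (Kloos.isCoord_coord hkn _) h2 i j
    rw [Kloos.param_unique hkn hc hc' (Kloos.isCoord_coord hkn _) (Kloos.isCoord_coord hkn _) h2]
  · rintro _ ⟨g, hg, rfl⟩
    obtain ⟨m, hm, a, ha, hu⟩ := Kloos.exists_bMap_mem_UZ_mul hkn hg
    obtain ⟨c, hc, X', hX', hint⟩ := Kloos.exists_param hkn (Kloos.isCoord_coord hkn a) ha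
    refine ⟨(m, c), ⟨hm, hc⟩, Kloos.doubleClass_eq_iff.mpr ?_⟩
    -- The integral translation carrying the representative back to a; it supplies the right factor
    -- in U_w(ℤ_p).
    set Z := Kloos.coord hkn a - X' with hZ
    have hZ' : ∀ i j, ‖Z i j‖ ≤ 1 := fun i j => by
      rw [hZ, Pi.sub_apply, Pi.sub_apply, norm_sub_rev]; exact hint i j
    have h1 := Kloos.bMap_mul_inv_mem_UZ hkn hX' (Kloos.isCoord_coord hkn a)
      (fun i j => (ha i j).trans (Kloos.param_mem_Y hc i j).symm) hZ' (by rw [hZ]; abel)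
    refine ⟨_, mul_mem hu h1, Kloos.blockUnip hkn Z, (Kloos.mem_UwZ_iff hkn).mpr ⟨Z, hZ', rfl⟩, ?_⟩
    group
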